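/- **Setting.** Let $d\in\mathbb N_0$, equip $\mathbb Z^d$ with the maximum-norm distance, and let $\mathcal H\neq\{0\}$ be a complex Hilbert space with $\dim\mathcal H<\infty$. For $x\in\mathbb Z^d$ let $p_x:\ell^2(\mathbb Z^d,\mathcal H)\to\mathcal H$, $p_xu=u(x)$, and $i_x=p_x^*$. For a finite $Q\subset\mathbb Z^d$ let $p_Q$ be the orthogonal projection onto the subspace $\ell^2(Q,\mathcal H)$ of elements supported in $Q$, $i_Q=p_Q^*$ the inclusion, $|Q|$ the cardinality of $Q$, and for an integer $S\ge 0$ let $$\partial^SQ=\{x\notin Q:\operatorname{dist}(x,Q)\le S\}\cup\{x\in Q:\operatorname{dist}(x,\mathbb Z^d\setminus Q)\le S\}.$$ Put $C_M=\{0,\dots,M-1\}^d$ and $C_M(a)=a+C_M$. A sequence $(Q_j)$ of nonempty finite subsets of $\mathbb Z^d$ is a *van Hove sequence* if $|\partial^SQ_j|/|Q_j|\to0$ for every integer $S\ge0$. For a selfadjoint operator $T$ on a finite-dimensional Hilbert space, $n(T)(\lambda)$ is the number of eigenvalues of $T$ not exceeding $\lambda\in\mathbb R$, counted with multiplicity.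 Let $\mathcal A$ be a finite set and $\Lambda:\mathbb Z^d\to\mathcal A$ a map (a colouring). A *box pattern at the origin* is a map $P:Q(P)\to\mathcal A$ with $Q(P)=\prod_{i=1}^d\{0,\dots,b_i\}$, $b_i\in\mathbb Z$, $b_i\ge0$; let $\mathcal P_M$ be the set of those with $Q(P)=C_M$. Such a $P$ *occurs in $\Lambda$ at $x$* if $\Lambda(x+z)=P(z)$ for all $z\in Q(P)$, and $\sharp_P(\Lambda\cap Q)$ is the number of $x\in Q$ with $x+Q(P)\subset Q$ at which $P$ occurs in $\Lambda$. Let $(Q_j)_{j\in\mathbb N}$ be a van Hove sequence such that for every box pattern $P$ at the origin the frequency $\nu_P=\lim_{j\to\infty}\sharp_P(\Lambda\cap Q_j)/|Q_j|$ exists. Let $H$ be a selfadjoint (bounded, everywhere defined) operator on $\ell^2(\mathbb Z^d,\mathcal H)$ and let $R_{fr},R_{inv}\ge0$ be integers such that * $p_yHi_x=0$ whenever $\operatorname{dist}(x,y)>R_{fr}$ (finite range), and * $p_yHi_x=p_{y+t}Hi_{x+t}$ for all $x,y,t\in\mathbb Z^d$ such that $\Lambda(z+t)=\Lambda(z)$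 for all $z\in C_{R_{inv}}(x)\cup C_{R_{inv}}(y)$ ($\Lambda$-invariance). Put $R=\max\{R_{fr},R_{inv}\}$. **Theorem 4.1.** There exists a unique probability measure $\mu_H$ on $\mathbb R$, with distribution function $N_H(\lambda)=\mu_H((-\infty,\lambda])$, such that $$\frac{n(p_{Q_j}Hi_{Q_j})}{|Q_j|\dim\mathcal H}\longrightarrow N_H\qquad(j\to\infty)$$ in the supremum norm on $\mathbb R$. Moreover, for all $j$ and all integers $M\ge1$, $$\left\|\frac{n(p_{Q_j}Hi_{Q_j})}{|Q_j|\dim\mathcal H}-N_H\right\|_\infty\le 8\,\frac{|\partial^RC_M|}{|C_M|}+\sum_{P\in\mathcal P_M}\left|\frac{\sharp_P(\Lambda\cap Q_j)}{|Q_j|}-\nu_P\right|+5\,|C_R|\,\frac{|\partial^MQ_j|}{|Q_j|}.$$ If in addition $\nu_P>0$ for every box pattern $P$ at the origin that occurs in $\Lambda$ at some point, then the spectrum of $H$ equals the topological support of $\mu_H$. -/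

import Mathlib

open Filter Topology MeasureTheory

noncomputable section

namespace ZdIDS

/-- The lattice `ℤ^d`; its metric is the one induced by the maximum norm. -/
abbrev Lattice (d : ℕ) : Type := Fin d → ℤ

/-- The cube `C_M(a) = a + {0, …, M - 1}^d`. -/
def cubeAt {d : ℕ} (M : ℕ) (a : Lattice d) : Finset (Lattice d) :=
  Finset.Icc a (fun i => a i + (M : ℤ) - 1)

/-- The cube `C_M = {0, …, M - 1}^d`. -/
def cube (d M : ℕ) : Finset (Lattice d) := cubeAt M 0

/-- The `S`-boundary of a finite set `Q`. All distances are integers, so that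
`dist (x, A) ≤ S` means that some point of `A` has distance at most `S` from `x`. -/
def boundary {d : ℕ} (S : ℕ) (Q : Finset (Lattice d)) : Set (Lattice d) :=
  {x | x ∉ Q ∧ ∃ y ∈ Q, dist x y ≤ (S : ℝ)} ∪ {x | x ∈ Q ∧ ∃ y, y ∉ Q ∧ dist x y ≤ (S : ℝ)}

/-- The boundary is a finite set, so its `Set.ncard` is its number of elements. -/
theorem finite_boundary {d : ℕ} (S : ℕ) (Q : Finset (Lattice d)) : (boundary S Q).Finite := by
  refine Set.Finite.union ?_ (Q.finite_toSet.subset fun x hx => hx.1)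
  refine (Q.finite_toSet.biUnion
    (fun y _ => (isCompact_closedBall y (S : ℝ)).finite_of_discrete)).subset ?_
  rintro x ⟨-, y, hy, hxy⟩
  simp only [Set.mem_iUnion]
  exact ⟨y, hy, Metric.mem_closedBall.2 hxy⟩

/-- Van Hove sequences of (nonempty) finite sets. -/
def IsVanHove {d : ℕ} (Q : ℕ → Finset (Lattice d)) : Prop :=
  (∀ j, (Q j).Nonempty) ∧
    ∀ S : ℕ, Tendsto (fun j => ((boundary S (Q j)).ncard : ℝ) / ((Q j).card : ℝ)) atTop (𝓝 0)

/-- A pattern: a map from a finite subset of the lattice to the set of colours. -/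
structure Pattern (d : ℕ) (A : Type*) where
  dom : Finset (Lattice d)
  col : dom → A

/-- The domain of the pattern is a box `[0, b_1] × ⋯ × [0, b_d]` with all `b_i ≥ 0`. -/
def Pattern.IsBoxAtOrigin {d : ℕ} {A : Type*} (P : Pattern d A) : Prop :=
  ∃ b : Lattice d, 0 ≤ b ∧ P.dom = Finset.Icc 0 b

/-- The translate `x + P` is the restriction of the colouring `Λ` to `x + Q(P)`. -/
def Pattern.OccursAt {d : ℕ} {A : Type*} (P : Pattern d A) (Λ : Lattice d → A)
    (x : Lattice d) : Prop :=
  ∀ z : P.dom, Λ (x + z) = P.col z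

open Classical in
/-- The number `♯_P (Λ ∩ Q)` of occurrences of `P` in the restriction of `Λ` to `Q`. -/
def Pattern.count {d : ℕ} {A : Type*} (P : Pattern d A) (Λ : Lattice d → A)
    (Q : Finset (Lattice d)) : ℕ :=
  (Q.filter fun x => (∀ z ∈ P.dom, x + z ∈ Q) ∧ P.OccursAt Λ x).card

/-- `ν` is the frequency of `P` in `Λ` along the sequence `Q`. -/
def HasFrequency {d : ℕ} {A : Type*} (Λ : Lattice d → A) (Q : ℕ → Finset (Lattice d))
    (P : Pattern d A) (ν : ℝ) : Prop :=
  Tendsto (fun j => (P.count Λ (Q j) : ℝ) / ((Q j).card : ℝ)) atTop (𝓝 ν)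

section Operators

variable {d : ℕ} {𝓗 : Type*} [NormedAddCommGroup 𝓗] [InnerProductSpace ℂ 𝓗]

/-- The Hilbert space `ℓ²(ℤ^d, 𝓗)`. -/
abbrev L2 (d : ℕ) (𝓗 : Type*) [NormedAddCommGroup 𝓗] : Type _ :=
  lp (fun _ : Lattice d => 𝓗) 2

/-- The matrix element `p_y H i_x` applied to `v`, where `i_x v` is the function with value `v`
at `x` and `0` elsewhere, and `p_y u = u y`. -/
def entry (H : L2 d 𝓗 →L[ℂ] L2 d 𝓗) (y x : Lattice d) (v : 𝓗) : 𝓗 :=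
  (H (lp.single 2 x v) : L2 d 𝓗) y

/-- `H` has finite range, with range `r`. -/
def HasRange (H : L2 d 𝓗 →L[ℂ] L2 d 𝓗) (r : ℕ) : Prop :=
  ∀ x y : Lattice d, (r : ℝ) < dist x y → ∀ v, entry H y x v = 0

/-- `H` is `Λ`-invariant, with invariance length `r`: the matrix element `p_y H i_x` does not
change under a translation `t` that carries the pattern of `Λ` on `C_r(x) ∪ C_r(y)` to that on
`C_r(x + t) ∪ C_r(y + t)`. -/
def IsInvariantWith {A : Type*} (Λ : Lattice d → A) (H : L2 d 𝓗 →L[ℂ] L2 d 𝓗) (r : ℕ) : Prop :=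
  ∀ x y t : Lattice d, (∀ z ∈ cubeAt r x ∪ cubeAt r y, Λ (z + t) = Λ z) →
    ∀ v, entry H y x v = entry H (y + t) (x + t) v

/-- The subspace `ℓ²(Q, 𝓗)` of the elements supported in `Q`. -/
def supportedIn (𝓗 : Type*) [NormedAddCommGroup 𝓗] [InnerProductSpace ℂ 𝓗]
    (Q : Finset (Lattice d)) : Submodule ℂ (L2 d 𝓗) where
  carrier := {u | ∀ x, x ∉ Q → u x = 0}
  zero_mem' := fun x _ => by simp
  add_mem' := fun {u v} hu hv x hx => by simp [hu x hx, hv x hx]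
  smul_mem' := fun c u hu x hx => by simp [hu x hx]

instance [FiniteDimensional ℂ 𝓗] (Q : Finset (Lattice d)) :
    FiniteDimensional ℂ (supportedIn 𝓗 Q) := by
  let f : supportedIn 𝓗 Q →ₗ[ℂ] (Q → 𝓗) :=
    { toFun := fun u q => (u : L2 d 𝓗) q
      map_add' := fun u v => by ext; simp
      map_smul' := fun c u => by ext; simp }
  refine FiniteDimensional.of_injective f fun u v huv => ?_
  ext x
  by_cases hx : x ∈ Q
  · exact congrFun huv ⟨x, hx⟩
  · rw [u.2 x hx, v.2 x hx]

/-- The finite-volume operator `p_Q H i_Q` on `ℓ²(Q, 𝓗)`: `i_Q` is the inclusion and `p_Q` the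
orthogonal projection. -/
def compression [FiniteDimensional ℂ 𝓗] (H : L2 d 𝓗 →L[ℂ] L2 d 𝓗) (Q : Finset (Lattice d)) :
    supportedIn 𝓗 Q →L[ℂ] supportedIn 𝓗 Q :=
  (supportedIn 𝓗 Q).orthogonalProjectionOnto ∘L H ∘L (supportedIn 𝓗 Q).subtypeL

theorem compression_isSymmetric [FiniteDimensional ℂ 𝓗] [CompleteSpace 𝓗]
    {H : L2 d 𝓗 →L[ℂ] L2 d 𝓗} (hH : IsSelfAdjoint H) (Q : Finset (Lattice d)) :
    (compression H Q : supportedIn 𝓗 Q →ₗ[ℂ] supportedIn 𝓗 Q).IsSymmetric := by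
  intro u v
  have h := (ContinuousLinearMap.isSelfAdjoint_iff_isSymmetric.1 hH) (u : L2 d 𝓗) (v : L2 d 𝓗)
  simpa [compression] using h

end Operators

/-- The cumulative eigenvalue counting function `n(T)`: the number of eigenvalues of `T` not
exceeding `t`, counted with multiplicity. -/
def eigenvalueCount {V : Type*} [NormedAddCommGroup V] [InnerProductSpace ℂ V]
    [FiniteDimensional ℂ V] {T : V →ₗ[ℂ] V} (hT : T.IsSymmetric) (t : ℝ) : ℕ :=
  (Finset.univ.filter fun k : Fin (Module.finrank ℂ V) => hT.eigenvalues rfl k ≤ t).card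

/-- The normalised finite-volume eigenvalue counting function
`n(p_Q H i_Q) / (|Q| dim 𝓗)`; here `|Q| dim 𝓗 = dim ℓ²(Q, 𝓗)`. -/
def normalisedCount {d : ℕ} {𝓗 : Type*} [NormedAddCommGroup 𝓗] [InnerProductSpace ℂ 𝓗]
    [FiniteDimensional ℂ 𝓗] [CompleteSpace 𝓗] {H : L2 d 𝓗 →L[ℂ] L2 d 𝓗} (hH : IsSelfAdjoint H)
    (Q : Finset (Lattice d)) (t : ℝ) : ℝ :=
  (eigenvalueCount (compression_isSymmetric hH Q) t : ℝ) /
    ((Q.card : ℝ) * (Module.finrank ℂ 𝓗 : ℝ))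

/-- The distribution function of `μ` is the limit, in supremum norm, of the normalised
eigenvalue counting functions along `Q`. -/
def IsDensityOfStates {d : ℕ} {𝓗 : Type*} [NormedAddCommGroup 𝓗] [InnerProductSpace ℂ 𝓗]
    [FiniteDimensional ℂ 𝓗] [CompleteSpace 𝓗] {H : L2 d 𝓗 →L[ℂ] L2 d 𝓗} (hH : IsSelfAdjoint H)
    (Q : ℕ → Finset (Lattice d)) (μ : ProbabilityMeasure ℝ) : Prop :=
  TendstoUniformly (fun j => normalisedCount hH (Q j))
    (fun t => ProbabilityTheory.cdf (μ : Measure ℝ) t) atTop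

end ZdIDS

end

/-! The eigenvalue count at level `t` is the largest dimension of a subspace on which the quadratic
form is at most `t‖u‖²`. Three facts follow for volumes: shrinking `Q` to `U` changes the count by
at most `|Q \ U| dim 𝓗`; translations preserving the matrix entries preserve it; and it is additive
over sets farther apart than the range of `H`.

Cut `Q` into cubes of side `M` along a grid and shrink each cube to its `R`-core. The cores
decouple, and the count on a core depends only on the pattern of `Λ` on its cube. Averaging over all
`M ^ d` positions of the grid uses each cube inside `Q` exactly once, so pattern counts appear.
Hence `abs_normalisedCount_sub_blockAverage_le`: the normalised count is close to a function
determined by `ν` alone, uniformly in the energy. This makes the counts uniformly Cauchy, and their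
limit is a distribution function. Letting `j → ∞` in the same bound and using the triangle
inequality gives the error estimate, except when `C_R` is empty, where the counts do not depend on
the volume at all.

For the spectrum, a point of it has a finitely supported approximate eigenvector. This can be copied
to every occurrence of the pattern it sees; disjoint copies are orthogonal, and positive frequency
turns their number into positive mass near the point. Conversely, if `H - l` is bounded below, no
finite-volume approximate eigenvector lives in the core of `Q`, so a window around `l` holds at most
`|∂^R Q| dim 𝓗` eigenvalues, a negligible proportion. -/

noncomputable section

namespace ZdIDS

/-! ### Variational bounds for eigenvalue counts -/

section LinearAlgebra

open Module

variable {V : Type*} [NormedAddCommGroup V] [InnerProductSpace ℂ V] [FiniteDimensional ℂ V]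
  {T : V →ₗ[ℂ] V} (hT : T.IsSymmetric)

/-- The span of the eigenvectors of `T` whose index lies in `S`. -/
def eigenSpan (S : Finset (Fin (finrank ℂ V))) : Submodule ℂ V :=
  Submodule.span ℂ (hT.eigenvectorBasis rfl '' S)

theorem finrank_eigenSpan (S : Finset (Fin (finrank ℂ V))) :
    finrank ℂ (eigenSpan hT S) = S.card := by
  have hli : LinearIndependent ℂ (fun k : S => hT.eigenvectorBasis rfl (k : Fin (finrank ℂ V))) :=
    (hT.eigenvectorBasis rfl).orthonormal.linearIndependent.comp _ Subtype.val_injective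
  have h := finrank_span_eq_card hli
  rw [Fintype.card_coe] at h
  rw [← h, eigenSpan, Set.image_eq_range]
  rfl

theorem inner_eq_zero_of_mem_eigenSpan {S : Finset (Fin (finrank ℂ V))} {u : V}
    (hu : u ∈ eigenSpan hT S) {k : Fin (finrank ℂ V)} (hk : k ∉ S) :
    inner ℂ (hT.eigenvectorBasis rfl k) u = 0 := by
  have h : eigenSpan hT S ≤ (ℂ ∙ hT.eigenvectorBasis rfl k)ᗮ := by
    refine Submodule.span_le.2 ?_
    rintro _ ⟨l, hl, rfl⟩
    refine Submodule.mem_orthogonal_singleton_iff_inner_right.2 ?_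
    exact (hT.eigenvectorBasis rfl).orthonormal.inner_eq_zero fun h => hk (h ▸ hl)
  exact Submodule.mem_orthogonal_singleton_iff_inner_right.1 (h hu)

theorem inner_eigenvectorBasis_apply (u : V) (k : Fin (finrank ℂ V)) :
    inner ℂ (hT.eigenvectorBasis rfl k) (T u) =
      hT.eigenvalues rfl k * inner ℂ (hT.eigenvectorBasis rfl k) u := by
  rw [← hT, hT.apply_eigenvectorBasis, inner_smul_left]
  simp

theorem re_inner_apply_eq_sum (u : V) :
    (inner ℂ (T u) u).re =
      ∑ k, hT.eigenvalues rfl k * ‖inner ℂ (hT.eigenvectorBasis rfl k) u‖ ^ 2 := by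
  rw [← (hT.eigenvectorBasis rfl).sum_inner_mul_inner, Complex.re_sum]
  refine Finset.sum_congr rfl fun k _ => ?_
  rw [← inner_conj_symm, inner_eigenvectorBasis_apply, map_mul, Complex.conj_ofReal, mul_assoc,
    Complex.conj_mul', Complex.re_ofReal_mul]
  norm_cast

theorem norm_sq_eq_sum (u : V) :
    ‖u‖ ^ 2 = ∑ k, ‖inner ℂ (hT.eigenvectorBasis rfl k) u‖ ^ 2 :=
  ((hT.eigenvectorBasis rfl).sum_sq_norm_inner_right u).symm

theorem norm_apply_sub_smul_sq (u : V) (l : ℝ) :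
    ‖T u - (l : ℂ) • u‖ ^ 2 =
      ∑ k, (hT.eigenvalues rfl k - l) ^ 2 * ‖inner ℂ (hT.eigenvectorBasis rfl k) u‖ ^ 2 := by
  rw [norm_sq_eq_sum hT]
  refine Finset.sum_congr rfl fun k _ => ?_
  rw [inner_sub_right, inner_eigenvectorBasis_apply, inner_smul_right, ← sub_mul, norm_mul,
    ← Complex.ofReal_sub, Complex.norm_real, mul_pow, Real.norm_eq_abs, sq_abs]

theorem exists_inner_ne_zero {u : V} (hu : u ≠ 0) :
    ∃ k, inner ℂ (hT.eigenvectorBasis rfl k) u ≠ 0 := by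
  by_contra! h
  refine hu (norm_eq_zero.1 (pow_eq_zero_iff (n := 2) two_ne_zero |>.1 ?_))
  rw [norm_sq_eq_sum hT]
  simp [h]

/-- Weighted sums over the eigenvector expansion of an element of an `eigenSpan` are monotone
in the weights on the index set. -/
theorem sum_le_sum_of_mem_eigenSpan {S : Finset (Fin (finrank ℂ V))} {u : V}
    (hu : u ∈ eigenSpan hT S) {f g : Fin (finrank ℂ V) → ℝ} (hfg : ∀ k ∈ S, f k ≤ g k) :
    ∑ k, f k * ‖inner ℂ (hT.eigenvectorBasis rfl k) u‖ ^ 2 ≤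
      ∑ k, g k * ‖inner ℂ (hT.eigenvectorBasis rfl k) u‖ ^ 2 := by
  refine Finset.sum_le_sum fun k _ => ?_
  by_cases hk : k ∈ S
  · exact mul_le_mul_of_nonneg_right (hfg k hk) (by positivity)
  · simp [inner_eq_zero_of_mem_eigenSpan hT hu hk]

theorem sum_lt_sum_of_mem_eigenSpan {S : Finset (Fin (finrank ℂ V))} {u : V}
    (hu : u ∈ eigenSpan hT S) (hu0 : u ≠ 0) {f g : Fin (finrank ℂ V) → ℝ}
    (hfg : ∀ k ∈ S, f k < g k) :
    ∑ k, f k * ‖inner ℂ (hT.eigenvectorBasis rfl k) u‖ ^ 2 <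
      ∑ k, g k * ‖inner ℂ (hT.eigenvectorBasis rfl k) u‖ ^ 2 := by
  obtain ⟨k, hk⟩ := exists_inner_ne_zero hT hu0
  refine Finset.sum_lt_sum (fun k _ => ?_) ⟨k, Finset.mem_univ k, ?_⟩
  · by_cases hk : k ∈ S
    · exact mul_le_mul_of_nonneg_right (hfg k hk).le (by positivity)
    · simp [inner_eq_zero_of_mem_eigenSpan hT hu hk]
  · have hkS : k ∈ S := by
      by_contra h
      exact hk (inner_eq_zero_of_mem_eigenSpan hT hu h)
    exact mul_lt_mul_of_pos_right (hfg k hkS) (by positivity)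

/-- Each bound below chooses `S` so that the spectral estimate on `eigenSpan hT S` contradicts the
assumption on `W` for any common nonzero vector. -/
theorem finrank_add_card_le_of_disjoint {S : Finset (Fin (finrank ℂ V))} {W : Submodule ℂ V}
    (h : ∀ u ∈ W, u ∈ eigenSpan hT S → u = 0) : finrank ℂ W + S.card ≤ finrank ℂ V := by
  rw [← finrank_eigenSpan hT S]
  exact Submodule.finrank_add_finrank_le_of_disjoint (Submodule.disjoint_def.2 h)

theorem eigenvalueCount_add_card (t : ℝ) :
    eigenvalueCount hT t + (Finset.univ.filter fun k => t < hT.eigenvalues rfl k).card =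
      finrank ℂ V := by
  have h := Finset.card_filter_add_card_filter_not (s := Finset.univ)
    (fun k : Fin (finrank ℂ V) => hT.eigenvalues rfl k ≤ t)
  simp only [not_le, Finset.card_univ, Fintype.card_fin] at h
  exact h

theorem finrank_le_eigenvalueCount {t : ℝ} {W : Submodule ℂ V}
    (h : ∀ u ∈ W, (inner ℂ (T u) u).re ≤ t * ‖u‖ ^ 2) : finrank ℂ W ≤ eigenvalueCount hT t := by
  have key := finrank_add_card_le_of_disjoint hT (W := W)
    (S := Finset.univ.filter fun k => t < hT.eigenvalues rfl k) fun u hu hu' => by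
      by_contra hu0
      have := sum_lt_sum_of_mem_eigenSpan hT hu' hu0 (f := fun _ => t)
        (g := hT.eigenvalues rfl) fun k hk => (Finset.mem_filter.1 hk).2
      rw [← re_inner_apply_eq_sum, ← Finset.mul_sum, ← norm_sq_eq_sum] at this
      exact absurd (h u hu) this.not_ge
  have := eigenvalueCount_add_card hT t
  omega

theorem finrank_add_eigenvalueCount_le {t : ℝ} {E : Submodule ℂ V}
    (h : ∀ u ∈ E, u ≠ 0 → t * ‖u‖ ^ 2 < (inner ℂ (T u) u).re) :
    finrank ℂ E + eigenvalueCount hT t ≤ finrank ℂ V := by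
  refine finrank_add_card_le_of_disjoint hT
    (S := Finset.univ.filter fun k => hT.eigenvalues rfl k ≤ t) fun u hu hu' => ?_
  by_contra hu0
  have := sum_le_sum_of_mem_eigenSpan hT hu' (f := hT.eigenvalues rfl) (g := fun _ => t)
    fun k hk => (Finset.mem_filter.1 hk).2
  rw [← re_inner_apply_eq_sum, ← Finset.mul_sum, ← norm_sq_eq_sum] at this
  exact absurd (h u hu hu0) this.not_gt

/-- The spectral subspace attains the bound of `finrank_le_eigenvalueCount`, so counts can be
compared by moving trial spaces from one operator to another. -/
theorem exists_finrank_eq_eigenvalueCount (t : ℝ) :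
    ∃ W : Submodule ℂ V, finrank ℂ W = eigenvalueCount hT t ∧
      ∀ u ∈ W, (inner ℂ (T u) u).re ≤ t * ‖u‖ ^ 2 := by
  refine ⟨eigenSpan hT (Finset.univ.filter fun k => hT.eigenvalues rfl k ≤ t),
    finrank_eigenSpan _ _, fun u hu => ?_⟩
  have := sum_le_sum_of_mem_eigenSpan hT hu (f := hT.eigenvalues rfl) (g := fun _ => t)
    fun k hk => (Finset.mem_filter.1 hk).2
  rwa [← re_inner_apply_eq_sum, ← Finset.mul_sum, ← norm_sq_eq_sum] at this

theorem exists_finrank_add_eigenvalueCount_eq (t : ℝ) :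
    ∃ E : Submodule ℂ V, finrank ℂ E + eigenvalueCount hT t = finrank ℂ V ∧
      ∀ u ∈ E, u ≠ 0 → t * ‖u‖ ^ 2 < (inner ℂ (T u) u).re := by
  refine ⟨eigenSpan hT (Finset.univ.filter fun k => t < hT.eigenvalues rfl k), ?_,
    fun u hu hu0 => ?_⟩
  · rw [finrank_eigenSpan, add_comm, eigenvalueCount_add_card]
  · have := sum_lt_sum_of_mem_eigenSpan hT hu hu0 (f := fun _ => t) (g := hT.eigenvalues rfl)
      fun k hk => (Finset.mem_filter.1 hk).2
    rwa [← re_inner_apply_eq_sum, ← Finset.mul_sum, ← norm_sq_eq_sum] at this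

/-- A space of approximate eigenvectors forces eigenvalues in a window. -/
theorem finrank_le_eigenvalueCount_sub {l ε : ℝ} (hε : 0 < ε) {W : Submodule ℂ V}
    (h : ∀ u ∈ W, ‖T u - (l : ℂ) • u‖ ≤ ε * ‖u‖) :
    finrank ℂ W + eigenvalueCount hT (l - 2 * ε) ≤ eigenvalueCount hT (l + ε) := by
  have key := finrank_add_card_le_of_disjoint hT (W := W)
    (S := Finset.univ.filter fun k => ε ^ 2 < (hT.eigenvalues rfl k - l) ^ 2) fun u hu hu' => by
      by_contra hu0
      have := sum_lt_sum_of_mem_eigenSpan hT hu' hu0 (f := fun _ => ε ^ 2)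
        (g := fun k => (hT.eigenvalues rfl k - l) ^ 2) fun k hk => (Finset.mem_filter.1 hk).2
      rw [← norm_apply_sub_smul_sq, ← Finset.mul_sum, ← norm_sq_eq_sum, ← mul_pow] at this
      exact absurd (pow_le_pow_left₀ (norm_nonneg _) (h u hu) 2) this.not_ge
  have h1 := eigenvalueCount_add_card hT (l + ε)
  -- The lower end is `l - 2 * ε` because the count includes its endpoint: an eigenvalue equal to `l
  -- - ε` would not be strictly farther than `ε` from `l`.
  have h2 : eigenvalueCount hT (l - 2 * ε) +
      (Finset.univ.filter fun k => l + ε < hT.eigenvalues rfl k).card ≤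
      (Finset.univ.filter fun k => ε ^ 2 < (hT.eigenvalues rfl k - l) ^ 2).card := by
    rw [eigenvalueCount, ← Finset.card_union_of_disjoint]
    · refine Finset.card_le_card fun k hk => ?_
      simp only [Finset.mem_union, Finset.mem_filter, Finset.mem_univ, true_and] at hk ⊢
      rcases hk with hk | hk <;> nlinarith
    · refine Finset.disjoint_filter.2 fun k _ h1 h2 => ?_
      linarith
  omega

/-- Eigenvalues in a window give a space of approximate eigenvectors. -/
theorem exists_finrank_add_eigenvalueCount_ge {l ε : ℝ} (hε : 0 < ε) :
    ∃ W : Submodule ℂ V, eigenvalueCount hT (l + ε) ≤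
      finrank ℂ W + eigenvalueCount hT (l - ε) ∧
      ∀ u ∈ W, ‖T u - (l : ℂ) • u‖ ≤ ε * ‖u‖ := by
  refine ⟨eigenSpan hT (Finset.univ.filter fun k => (hT.eigenvalues rfl k - l) ^ 2 ≤ ε ^ 2),
    ?_, fun u hu => ?_⟩
  · rw [finrank_eigenSpan, eigenvalueCount, eigenvalueCount]
    refine le_trans (Finset.card_le_card fun k hk => ?_) (Finset.card_union_le _ _)
    simp only [Finset.mem_union, Finset.mem_filter, Finset.mem_univ, true_and] at hk ⊢
    by_cases h : hT.eigenvalues rfl k ≤ l - ε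
    · exact Or.inr h
    · exact Or.inl (by nlinarith)
  · refine le_of_sq_le_sq ?_ (by positivity)
    have := sum_le_sum_of_mem_eigenSpan hT hu (f := fun k => (hT.eigenvalues rfl k - l) ^ 2)
      (g := fun _ => ε ^ 2) fun k hk => (Finset.mem_filter.1 hk).2
    rwa [← norm_apply_sub_smul_sq, ← Finset.mul_sum, ← norm_sq_eq_sum, ← mul_pow] at this

end LinearAlgebra

/-! ### Finitely supported vectors and finite-volume operators -/

section FiniteVolume

open Module

theorem sum_single_apply {d : ℕ} {𝓗 : Type*} [NormedAddCommGroup 𝓗] {ι : Type*} (s : Finset ι) (f : ι → Lattice d) (g : ι → 𝓗)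
    (y : Lattice d) :
    (∑ i ∈ s, lp.single 2 (f i) (g i) : L2 d 𝓗) y = ∑ i ∈ s, if y = f i then g i else 0 := by
  rw [lp.coeFn_sum, Finset.sum_apply]
  refine Finset.sum_congr rfl fun i _ => ?_
  rw [lp.single_apply, Pi.single_apply]

variable {d : ℕ} {𝓗 : Type*} [NormedAddCommGroup 𝓗] [InnerProductSpace ℂ 𝓗]

theorem supportedIn_mono {U Q : Finset (Lattice d)} (h : U ⊆ Q) :
    supportedIn 𝓗 U ≤ supportedIn 𝓗 Q := fun _ hu x hx => hu x fun hxU => hx (h hxU)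

theorem eq_sum_single {Q : Finset (Lattice d)} {u : L2 d 𝓗} (hu : u ∈ supportedIn 𝓗 Q) :
    u = ∑ x ∈ Q, lp.single 2 x (u x) := by
  ext y
  rw [sum_single_apply Q (fun x => x) fun x => u x, Finset.sum_ite_eq]
  split_ifs with h
  · rfl
  · exact hu y h

theorem inner_eq_sum {Q : Finset (Lattice d)} (w : L2 d 𝓗) {u : L2 d 𝓗}
    (hu : u ∈ supportedIn 𝓗 Q) : inner ℂ w u = ∑ x ∈ Q, inner ℂ (w x) (u x) := by
  rw [lp.inner_eq_tsum]
  exact tsum_eq_sum fun x hx => by rw [hu x hx, inner_zero_right]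

theorem norm_sq_eq_sum_of_mem {Q : Finset (Lattice d)} {u : L2 d 𝓗}
    (hu : u ∈ supportedIn 𝓗 Q) : ‖u‖ ^ 2 = ∑ x ∈ Q, ‖u x‖ ^ 2 := by
  have h := inner_eq_sum u hu
  simp only [inner_self_eq_norm_sq_to_K] at h
  exact_mod_cast h

theorem inner_eq_zero_of_disjoint {P Q : Finset (Lattice d)} (h : Disjoint P Q) {u v : L2 d 𝓗}
    (hu : u ∈ supportedIn 𝓗 P) (hv : v ∈ supportedIn 𝓗 Q) : inner ℂ u v = 0 := by
  rw [inner_eq_sum u hv]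
  refine Finset.sum_eq_zero fun x hx => ?_
  rw [hu x (Finset.disjoint_right.1 h hx), inner_zero_left]

theorem apply_eq_sum_entry (H : L2 d 𝓗 →L[ℂ] L2 d 𝓗) {Q : Finset (Lattice d)} {u : L2 d 𝓗}
    (hu : u ∈ supportedIn 𝓗 Q) (y : Lattice d) : H u y = ∑ x ∈ Q, entry H y x (u x) := by
  conv_lhs => rw [eq_sum_single hu]
  rw [map_sum, lp.coeFn_sum, Finset.sum_apply]
  rfl

theorem apply_eq_zero_of_hasRange {H : L2 d 𝓗 →L[ℂ] L2 d 𝓗} {r : ℕ} (hr : HasRange H r)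
    {Q : Finset (Lattice d)} {u : L2 d 𝓗} (hu : u ∈ supportedIn 𝓗 Q) {y : Lattice d}
    (hy : ∀ x ∈ Q, (r : ℝ) < dist x y) : H u y = 0 := by
  rw [apply_eq_sum_entry H hu]
  exact Finset.sum_eq_zero fun x hx => hr x y (hy x hx) _

theorem finrank_supportedIn [FiniteDimensional ℂ 𝓗] (Q : Finset (Lattice d)) :
    finrank ℂ (supportedIn 𝓗 Q) = Q.card * finrank ℂ 𝓗 := by
  let f : supportedIn 𝓗 Q →ₗ[ℂ] (Q → 𝓗) :=
    { toFun := fun u q => (u : L2 d 𝓗) q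
      map_add' := fun u v => by ext; simp
      map_smul' := fun c u => by ext; simp }
  have hinj : Function.Injective f := fun u v huv => by
    ext x
    by_cases hx : x ∈ Q
    · exact congrFun huv ⟨x, hx⟩
    · rw [u.2 x hx, v.2 x hx]
  have hsurj : Function.Surjective f := fun g => by
    have happ := sum_single_apply Finset.univ (fun q : Q => (q : Lattice d)) g
    refine ⟨⟨∑ q : Q, lp.single 2 (q : Lattice d) (g q), fun x hx => ?_⟩, ?_⟩
    · rw [happ]
      exact Finset.sum_eq_zero fun q _ => if_neg fun h : x = q => hx (h ▸ q.2)
    · ext q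
      change (∑ q : Q, lp.single 2 (q : Lattice d) (g q) : L2 d 𝓗) q = g q
      rw [happ, Finset.sum_eq_single q]
      · simp
      · intro b _ hb
        exact if_neg fun h => hb (Subtype.ext h.symm)
      · simp
  rw [(LinearEquiv.ofBijective f ⟨hinj, hsurj⟩).finrank_eq, finrank_pi_fintype]
  simp

section Translation

/-- Restriction to `B` followed by translation by `t`. -/
def shift (𝓗 : Type*) [NormedAddCommGroup 𝓗] [InnerProductSpace ℂ 𝓗] (B : Finset (Lattice d))
    (t : Lattice d) : L2 d 𝓗 →ₗ[ℂ] L2 d 𝓗 where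
  toFun u := ∑ x ∈ B, lp.single 2 (x + t) (u x)
  map_add' u v := by simp [Finset.sum_add_distrib, lp.single_add]
  map_smul' c u := by simp [Finset.smul_sum, lp.single_smul]

/-- The translate `B + t`. -/
def translate (B : Finset (Lattice d)) (t : Lattice d) : Finset (Lattice d) :=
  B.map (addRightEmbedding t)

theorem mem_translate {B : Finset (Lattice d)} {t x : Lattice d} :
    x ∈ translate B t ↔ x - t ∈ B := by
  simp only [translate, Finset.mem_map, addRightEmbedding_apply]
  constructor
  · rintro ⟨y, hy, rfl⟩
    simpa using hy
  · exact fun h => ⟨x - t, h, by simp⟩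

theorem card_translate (B : Finset (Lattice d)) (t : Lattice d) :
    (translate B t).card = B.card := Finset.card_map _

theorem shift_apply_add (B : Finset (Lattice d)) (t : Lattice d) (u : L2 d 𝓗) (y : Lattice d) :
    shift 𝓗 B t u (y + t) = if y ∈ B then u y else 0 := by
  change (∑ x ∈ B, lp.single 2 (x + t) (u x) : L2 d 𝓗) (y + t) = _
  rw [sum_single_apply B (fun x => x + t) fun x => u x]
  simp

theorem shift_apply_add_of_mem {B : Finset (Lattice d)} (t : Lattice d) {u : L2 d 𝓗}
    (hu : u ∈ supportedIn 𝓗 B) (y : Lattice d) : shift 𝓗 B t u (y + t) = u y := by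
  rw [shift_apply_add]
  split_ifs with h
  · rfl
  · exact (hu y h).symm

theorem shift_mem (B : Finset (Lattice d)) (t : Lattice d) (u : L2 d 𝓗) :
    shift 𝓗 B t u ∈ supportedIn 𝓗 (translate B t) := fun x hx => by
  obtain ⟨y, rfl⟩ : ∃ y, x = y + t := ⟨x - t, by simp⟩
  rw [shift_apply_add, if_neg]
  simpa [mem_translate] using hx

theorem norm_shift {B : Finset (Lattice d)} (t : Lattice d) {u : L2 d 𝓗}
    (hu : u ∈ supportedIn 𝓗 B) : ‖shift 𝓗 B t u‖ = ‖u‖ := by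
  refine (sq_eq_sq₀ (norm_nonneg _) (norm_nonneg _)).1 ?_
  rw [norm_sq_eq_sum_of_mem (shift_mem B t u), norm_sq_eq_sum_of_mem hu, translate,
    Finset.sum_map]
  refine Finset.sum_congr rfl fun y _ => ?_
  rw [addRightEmbedding_apply, shift_apply_add_of_mem t hu]

/-- Invariance is only local, so `H` commutes with the translation only at those `y` whose entries
from the support of `u` are preserved; hence the pointwise form. -/
theorem apply_shift (H : L2 d 𝓗 →L[ℂ] L2 d 𝓗) {B : Finset (Lattice d)} {t : Lattice d}
    {u : L2 d 𝓗} (hu : u ∈ supportedIn 𝓗 B) {y : Lattice d}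
    (h : ∀ x ∈ B, ∀ v, entry H y x v = entry H (y + t) (x + t) v) :
    H (shift 𝓗 B t u) (y + t) = H u y := by
  rw [apply_eq_sum_entry H hu, apply_eq_sum_entry H (shift_mem B t u), translate,
    Finset.sum_map]
  refine Finset.sum_congr rfl fun x hx => ?_
  rw [addRightEmbedding_apply, shift_apply_add_of_mem t hu, h x hx]

end Translation

/-- The projection is invisible against vectors supported in `Q`. All volumes can thus be compared
through the one form of `H` on `ℓ²(ℤ^d, 𝓗)`. -/
theorem inner_compression [FiniteDimensional ℂ 𝓗] (H : L2 d 𝓗 →L[ℂ] L2 d 𝓗) (Q : Finset (Lattice d)) (u v : supportedIn 𝓗 Q) :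
    inner ℂ (compression H Q u) v = inner ℂ (H (u : L2 d 𝓗)) (v : L2 d 𝓗) := by
  simp [compression]

/-- The codimension of `ℓ²(U, 𝓗)` in `ℓ²(Q, 𝓗)` is `|Q \ U| dim 𝓗`, and intersecting with it costs
no more than that. -/
theorem finrank_le_finrank_inf_add [FiniteDimensional ℂ 𝓗] {U Q : Finset (Lattice d)} (hUQ : U ⊆ Q)
    {W : Submodule ℂ (L2 d 𝓗)} (hW : W ≤ supportedIn 𝓗 Q) :
    finrank ℂ W ≤ finrank ℂ ↥(W ⊓ supportedIn 𝓗 U) + (Q \ U).card * finrank ℂ 𝓗 := by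
  have : FiniteDimensional ℂ W := Submodule.finiteDimensional_of_le hW
  have h1 := Submodule.finrank_sup_add_finrank_inf_eq W (supportedIn 𝓗 U)
  have h2 : finrank ℂ ↥(W ⊔ supportedIn 𝓗 U) ≤ finrank ℂ (supportedIn 𝓗 Q) :=
    Submodule.finrank_mono (sup_le hW (supportedIn_mono hUQ))
  rw [finrank_supportedIn] at h1 h2
  rw [← Finset.card_sdiff_add_card_eq_card hUQ, add_mul] at h2
  omega

/-! ### Monotonicity, translation and additivity of the counts -/

section Count

variable [FiniteDimensional ℂ 𝓗] [CompleteSpace 𝓗] {H : L2 d 𝓗 →L[ℂ] L2 d 𝓗}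
  (hH : IsSelfAdjoint H)

/-- The eigenvalue counting function of the finite-volume operator `p_Q H i_Q`. -/
def volumeCount (Q : Finset (Lattice d)) (t : ℝ) : ℕ :=
  eigenvalueCount (compression_isSymmetric hH Q) t

theorem finrank_le_volumeCount {Q : Finset (Lattice d)} {t : ℝ} {W : Submodule ℂ (L2 d 𝓗)}
    (hW : W ≤ supportedIn 𝓗 Q) (h : ∀ u ∈ W, (inner ℂ (H u) u).re ≤ t * ‖u‖ ^ 2) :
    finrank ℂ W ≤ volumeCount hH Q t := by
  rw [← (Submodule.submoduleOfEquivOfLe hW).finrank_eq]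
  refine finrank_le_eigenvalueCount _ fun u hu => ?_
  have := h u hu
  rwa [← inner_compression] at this

theorem finrank_add_volumeCount_le {Q : Finset (Lattice d)} {t : ℝ} {W : Submodule ℂ (L2 d 𝓗)}
    (hW : W ≤ supportedIn 𝓗 Q) (h : ∀ u ∈ W, u ≠ 0 → t * ‖u‖ ^ 2 < (inner ℂ (H u) u).re) :
    finrank ℂ W + volumeCount hH Q t ≤ Q.card * finrank ℂ 𝓗 := by
  rw [← (Submodule.submoduleOfEquivOfLe hW).finrank_eq, ← finrank_supportedIn]
  refine finrank_add_eigenvalueCount_le _ fun u hu hu0 => ?_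
  have := h u hu fun h0 => hu0 (Subtype.ext h0)
  rwa [← inner_compression] at this

theorem exists_finrank_eq_volumeCount (Q : Finset (Lattice d)) (t : ℝ) :
    ∃ W ≤ supportedIn 𝓗 Q, finrank ℂ W = volumeCount hH Q t ∧
      ∀ u ∈ W, (inner ℂ (H u) u).re ≤ t * ‖u‖ ^ 2 := by
  obtain ⟨W, hW, h⟩ := exists_finrank_eq_eigenvalueCount (compression_isSymmetric hH Q) t
  refine ⟨W.map (supportedIn 𝓗 Q).subtype, Submodule.map_subtype_le _ _, ?_, ?_⟩
  · rw [Submodule.finrank_map_subtype_eq, hW, volumeCount]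
  · rintro _ ⟨u, hu, rfl⟩
    have := h u hu
    rwa [ContinuousLinearMap.coe_coe, inner_compression] at this

theorem exists_finrank_add_volumeCount_eq (Q : Finset (Lattice d)) (t : ℝ) :
    ∃ W ≤ supportedIn 𝓗 Q, finrank ℂ W + volumeCount hH Q t = Q.card * finrank ℂ 𝓗 ∧
      ∀ u ∈ W, u ≠ 0 → t * ‖u‖ ^ 2 < (inner ℂ (H u) u).re := by
  obtain ⟨W, hW, h⟩ := exists_finrank_add_eigenvalueCount_eq (compression_isSymmetric hH Q) t
  refine ⟨W.map (supportedIn 𝓗 Q).subtype, Submodule.map_subtype_le _ _, ?_, ?_⟩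
  · rw [Submodule.finrank_map_subtype_eq, volumeCount, hW, finrank_supportedIn]
  · rintro _ ⟨u, hu, rfl⟩ hu0
    have := h u hu fun h0 => hu0 (by simp [h0])
    rwa [ContinuousLinearMap.coe_coe, inner_compression] at this

theorem volumeCount_le (Q : Finset (Lattice d)) (t : ℝ) :
    volumeCount hH Q t ≤ Q.card * finrank ℂ 𝓗 := by
  obtain ⟨W, -, h, -⟩ := exists_finrank_add_volumeCount_eq hH Q t
  omega

theorem volumeCount_mono_set {U Q : Finset (Lattice d)} (hUQ : U ⊆ Q) (t : ℝ) :
    volumeCount hH U t ≤ volumeCount hH Q t := by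
  obtain ⟨W, hW, hd, h⟩ := exists_finrank_eq_volumeCount hH U t
  rw [← hd]
  exact finrank_le_volumeCount hH (hW.trans (supportedIn_mono hUQ)) h

theorem volumeCount_le_add {U Q : Finset (Lattice d)} (hUQ : U ⊆ Q) (t : ℝ) :
    volumeCount hH Q t ≤ volumeCount hH U t + (Q \ U).card * finrank ℂ 𝓗 := by
  obtain ⟨W, hW, hd, h⟩ := exists_finrank_eq_volumeCount hH Q t
  rw [← hd]
  refine (finrank_le_finrank_inf_add hUQ hW).trans (Nat.add_le_add_right ?_ _)
  exact finrank_le_volumeCount hH inf_le_right fun u hu => h u hu.1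

theorem volumeCount_translate_le {B : Finset (Lattice d)} {t : Lattice d}
    (h : ∀ x ∈ B, ∀ y ∈ B, ∀ v, entry H y x v = entry H (y + t) (x + t) v) (l : ℝ) :
    volumeCount hH B l ≤ volumeCount hH (translate B t) l := by
  obtain ⟨W, hW, hd, hl⟩ := exists_finrank_eq_volumeCount hH B l
  have : FiniteDimensional ℂ W := Submodule.finiteDimensional_of_le hW
  have hinj : Function.Injective ((shift 𝓗 B t).comp W.subtype) := by
    refine (injective_iff_map_eq_zero _).2 fun u hu => ?_
    have := norm_shift t (hW u.2)
    rw [show shift 𝓗 B t (u : L2 d 𝓗) = 0 from hu, norm_zero] at this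
    simpa using this.symm
  rw [← hd, ← LinearMap.finrank_range_of_inj hinj]
  refine finrank_le_volumeCount hH ?_ ?_
  · rintro _ ⟨u, rfl⟩
    exact shift_mem _ _ _
  · rintro _ ⟨u, rfl⟩
    have hu := hW u.2
    change (inner ℂ (H (shift 𝓗 B t u)) (shift 𝓗 B t u)).re ≤ l * ‖shift 𝓗 B t (u : L2 d 𝓗)‖ ^ 2
    rw [norm_shift t hu]
    convert hl u u.2 using 2
    rw [inner_eq_sum _ (shift_mem B t _), inner_eq_sum _ hu, translate, Finset.sum_map]
    refine Finset.sum_congr rfl fun y hy => ?_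
    rw [addRightEmbedding_apply, shift_apply_add_of_mem t hu,
      apply_shift H hu fun x hx => h x hx y hy]

theorem volumeCount_translate {B : Finset (Lattice d)} {t : Lattice d}
    (h : ∀ x ∈ B, ∀ y ∈ B, ∀ v, entry H y x v = entry H (y + t) (x + t) v) (l : ℝ) :
    volumeCount hH (translate B t) l = volumeCount hH B l := by
  refine le_antisymm ?_ (volumeCount_translate_le hH h l)
  have hB : translate (translate B t) (-t) = B := by
    ext x
    simp [mem_translate]
  conv_rhs => rw [← hB]
  refine volumeCount_translate_le hH (fun x hx y hy v => ?_) l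
  rw [mem_translate] at hx hy
  have := h _ hx _ hy v
  simp only [sub_add_cancel] at this
  simp only [← sub_eq_add_neg, this]

/-- Beyond the range the form has no cross terms, so it is an orthogonal sum. Sums of trial spaces
with form above `t` bound the count from above, those with form at most `t` from below. -/
theorem volumeCount_union {r : ℕ} (hr : HasRange H r) {U V : Finset (Lattice d)}
    (hUV : ∀ x ∈ U, ∀ y ∈ V, (r : ℝ) < dist x y) (t : ℝ) :
    volumeCount hH (U ∪ V) t = volumeCount hH U t + volumeCount hH V t := by
  have hdisj : Disjoint U V := Finset.disjoint_left.2 fun x hx hx' => by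
    have := hUV x hx x hx'
    rw [dist_self] at this
    exact absurd this (Nat.cast_nonneg r).not_gt
  have hVU : ∀ y ∈ V, ∀ x ∈ U, (r : ℝ) < dist y x := fun y hy x hx => by
    rw [dist_comm]; exact hUV x hx y hy
  have hform : ∀ u ∈ supportedIn 𝓗 U, ∀ v ∈ supportedIn 𝓗 V,
      (inner ℂ (H (u + v)) (u + v)).re = (inner ℂ (H u) u).re + (inner ℂ (H v) v).re := by
    intro u hu v hv
    have h1 : inner ℂ (H u) v = 0 := by
      rw [inner_eq_sum _ hv]
      refine Finset.sum_eq_zero fun y hy => ?_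
      rw [apply_eq_zero_of_hasRange hr hu fun x hx => hUV x hx y hy, inner_zero_left]
    have h2 : inner ℂ (H v) u = 0 := by
      rw [inner_eq_sum _ hu]
      refine Finset.sum_eq_zero fun y hy => ?_
      rw [apply_eq_zero_of_hasRange hr hv fun x hx => hVU x hx y hy, inner_zero_left]
    rw [map_add, inner_add_left, inner_add_right, inner_add_right, h1, h2]
    simp
  have hnorm : ∀ u ∈ supportedIn 𝓗 U, ∀ v ∈ supportedIn 𝓗 V,
      ‖u + v‖ ^ 2 = ‖u‖ ^ 2 + ‖v‖ ^ 2 := fun u hu v hv => by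
    simpa [sq] using
      norm_add_sq_eq_norm_sq_add_norm_sq_of_inner_eq_zero u v (inner_eq_zero_of_disjoint hdisj hu hv)
  have hdim : ∀ W₁ ≤ supportedIn 𝓗 U, ∀ W₂ ≤ supportedIn 𝓗 V,
      finrank ℂ ↥(W₁ ⊔ W₂) = finrank ℂ W₁ + finrank ℂ W₂ := by
    intro W₁ h₁ W₂ h₂
    have : FiniteDimensional ℂ W₁ := Submodule.finiteDimensional_of_le h₁
    have : FiniteDimensional ℂ W₂ := Submodule.finiteDimensional_of_le h₂
    have hbot : W₁ ⊓ W₂ = ⊥ := (Submodule.eq_bot_iff _).2 fun u hu =>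
      inner_self_eq_zero.1 (inner_eq_zero_of_disjoint hdisj (h₁ hu.1) (h₂ hu.2))
    rw [← Submodule.finrank_sup_add_finrank_inf_eq, hbot, finrank_bot, add_zero]
  have hle : ∀ W₁ ≤ supportedIn 𝓗 U, ∀ W₂ ≤ supportedIn 𝓗 V,
      W₁ ⊔ W₂ ≤ supportedIn 𝓗 (U ∪ V) := fun W₁ h₁ W₂ h₂ =>
    sup_le (h₁.trans (supportedIn_mono Finset.subset_union_left))
      (h₂.trans (supportedIn_mono Finset.subset_union_right))
  refine le_antisymm ?_ ?_
  · obtain ⟨W₁, hW₁, hd₁, h₁⟩ := exists_finrank_add_volumeCount_eq hH U t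
    obtain ⟨W₂, hW₂, hd₂, h₂⟩ := exists_finrank_add_volumeCount_eq hH V t
    have key := finrank_add_volumeCount_le hH (t := t) (hle W₁ hW₁ W₂ hW₂) fun w hw hw0 => by
      obtain ⟨u, hu, v, hv, rfl⟩ := Submodule.mem_sup.1 hw
      rw [hform u (hW₁ hu) v (hW₂ hv), hnorm u (hW₁ hu) v (hW₂ hv), mul_add]
      -- Strictness is available only for nonzero components, and at least one of the two is
      -- nonzero.
      by_cases hu0 : u = 0
      · have hv0 : v ≠ 0 := fun h => hw0 (by rw [hu0, h, add_zero])
        simpa [hu0] using h₂ v hv hv0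
      · by_cases hv0 : v = 0
        · simpa [hv0] using h₁ u hu hu0
        · exact add_lt_add (h₁ u hu hu0) (h₂ v hv hv0)
    rw [hdim W₁ hW₁ W₂ hW₂, Finset.card_union_of_disjoint hdisj, add_mul] at key
    omega
  · obtain ⟨W₁, hW₁, hd₁, h₁⟩ := exists_finrank_eq_volumeCount hH U t
    obtain ⟨W₂, hW₂, hd₂, h₂⟩ := exists_finrank_eq_volumeCount hH V t
    rw [← hd₁, ← hd₂, ← hdim W₁ hW₁ W₂ hW₂]
    refine finrank_le_volumeCount hH (hle W₁ hW₁ W₂ hW₂) fun w hw => ?_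
    obtain ⟨u, hu, v, hv, rfl⟩ := Submodule.mem_sup.1 hw
    rw [hform u (hW₁ hu) v (hW₂ hv), hnorm u (hW₁ hu) v (hW₂ hv), mul_add]
    exact add_le_add (h₁ u hu) (h₂ v hv)

theorem volumeCount_biUnion {r : ℕ} (hr : HasRange H r) {ι : Type*} [DecidableEq ι]
    (s : Finset ι) (U : ι → Finset (Lattice d))
    (hU : ∀ i ∈ s, ∀ j ∈ s, i ≠ j → ∀ x ∈ U i, ∀ y ∈ U j, (r : ℝ) < dist x y) (t : ℝ) :
    volumeCount hH (s.biUnion U) t = ∑ i ∈ s, volumeCount hH (U i) t := by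
  induction s using Finset.induction_on with
  | empty =>
    have := volumeCount_le hH ∅ t
    simpa using this
  | insert a s ha ih =>
    rw [Finset.biUnion_insert, Finset.sum_insert ha, ← ih fun i hi j hj =>
      hU i (Finset.mem_insert_of_mem hi) j (Finset.mem_insert_of_mem hj)]
    refine volumeCount_union hH hr (fun x hx y hy => ?_) t
    obtain ⟨j, hj, hy⟩ := Finset.mem_biUnion.1 hy
    exact hU a (Finset.mem_insert_self a s) j (Finset.mem_insert_of_mem hj)
      (fun h => ha (h ▸ hj)) x hx y hy

end Count

end FiniteVolume

/-! ### Cubes, cores and tilings of the lattice -/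

section Geometry

variable {d : ℕ}

theorem dist_le_natCast {x y : Lattice d} {r : ℕ} :
    dist x y ≤ (r : ℝ) ↔ ∀ i, |x i - y i| ≤ (r : ℤ) := by
  rw [dist_pi_le_iff (Nat.cast_nonneg r)]
  refine forall_congr' fun i => ?_
  rw [Int.dist_eq]
  exact_mod_cast Iff.rfl

theorem mem_cubeAt {M : ℕ} {a x : Lattice d} :
    x ∈ cubeAt M a ↔ ∀ i, a i ≤ x i ∧ x i < a i + M := by
  simp only [cubeAt, Finset.mem_Icc, Pi.le_def, ← forall_and]
  refine forall_congr' fun i => ?_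
  omega

theorem card_cubeAt (M : ℕ) (a : Lattice d) : (cubeAt M a).card = M ^ d := by
  simp [cubeAt, Pi.card_Icc]

theorem cubeAt_add (M : ℕ) (a t : Lattice d) : cubeAt M (a + t) = translate (cubeAt M a) t := by
  ext x
  simp only [mem_translate, mem_cubeAt, Pi.add_apply, Pi.sub_apply]
  refine forall_congr' fun i => ?_
  omega

theorem self_mem_cubeAt {M : ℕ} (hM : 1 ≤ M) (a : Lattice d) : a ∈ cubeAt M a :=
  mem_cubeAt.2 fun i => by omega

open Classical in
/-- The points of `Q` whose distance from the complement of `Q` exceeds `r`. -/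
def core (r : ℕ) (Q : Finset (Lattice d)) : Finset (Lattice d) :=
  Q.filter fun x => ∀ y, dist x y ≤ (r : ℝ) → y ∈ Q

theorem mem_core {r : ℕ} {Q : Finset (Lattice d)} {x : Lattice d} :
    x ∈ core r Q ↔ ∀ y, dist x y ≤ (r : ℝ) → y ∈ Q := by
  classical
  rw [core, Finset.mem_filter, and_iff_right_iff_imp]
  exact fun h => h x (by simp)

theorem core_subset (r : ℕ) (Q : Finset (Lattice d)) : core r Q ⊆ Q := by
  classical exact Finset.filter_subset _ _

theorem core_translate (r : ℕ) (Q : Finset (Lattice d)) (t : Lattice d) :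
    core r (translate Q t) = translate (core r Q) t := by
  ext x
  simp only [mem_translate, mem_core]
  constructor
  · intro h y hy
    have := h (y + t) (by rwa [← sub_add_cancel x t, dist_add_right])
    simpa using this
  · intro h y hy
    exact h (y - t) (by rwa [dist_sub_right])

theorem card_sdiff_core_le (r : ℕ) (Q : Finset (Lattice d)) :
    (Q \ core r Q).card ≤ (boundary r Q).ncard := by
  rw [← Set.ncard_coe_finset]
  refine Set.ncard_le_ncard (fun x hx => Or.inr ?_) (finite_boundary r Q)
  rw [Finset.mem_coe, Finset.mem_sdiff, mem_core] at hx
  push Not at hx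
  obtain ⟨hxQ, y, hy, hyQ⟩ := hx
  exact ⟨hxQ, y, hyQ, hy⟩

theorem card_cubeAt_sdiff_core_le (r M : ℕ) (a : Lattice d) :
    (cubeAt M a \ core r (cubeAt M a)).card ≤ (boundary r (cube d M)).ncard := by
  refine le_trans (le_of_eq ?_) (card_sdiff_core_le r (cube d M))
  rw [← zero_add a, cubeAt_add, core_translate,
    Finset.card_sdiff_of_subset (core_subset r _),
    Finset.card_sdiff_of_subset (s := translate _ _)]
  · simp only [card_translate, cube]
  · rw [← core_translate]
    exact core_subset _ _

/-- A point within `r` of the core of `P` still lies in `P`. This separation is what decouples the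
blocks. -/
theorem disjoint_core_dist {r : ℕ} {P Q : Finset (Lattice d)} (h : Disjoint P Q)
    {x y : Lattice d} (hx : x ∈ core r P) (hy : y ∈ core r Q) : (r : ℝ) < dist x y := by
  by_contra! hxy
  exact Finset.disjoint_left.1 h (mem_core.1 hx y hxy) (core_subset r Q hy)

/-- The class of a lattice point modulo `M`. -/
def residue (M : ℕ) (x : Lattice d) : Fin d → ZMod M := fun i => (x i : ZMod M)

theorem eq_of_residue_eq {M : ℕ} {x x' y : Lattice d} (h : residue M x = residue M x')
    (hx : y ∈ cubeAt M x) (hx' : y ∈ cubeAt M x') : x = x' := by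
  ext i
  have h1 := mem_cubeAt.1 hx i
  have h2 := mem_cubeAt.1 hx' i
  have h3 : (M : ℤ) ∣ x' i - x i := (ZMod.intCast_eq_intCast_iff_dvd_sub _ _ _).1 (congrFun h i)
  have h4 := Int.eq_zero_of_abs_lt_dvd h3 (abs_lt.2 ⟨by omega, by omega⟩)
  omega

theorem disjoint_cubeAt {M : ℕ} {x x' : Lattice d} (h : residue M x = residue M x')
    (hne : x ≠ x') : Disjoint (cubeAt M x) (cubeAt M x') :=
  Finset.disjoint_left.2 fun _ hy hy' => hne (eq_of_residue_eq h hy hy')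

/-- Together with `eq_of_residue_eq`: the cubes with corners in a fixed class modulo `M` partition
the lattice. -/
theorem exists_residue_eq {M : ℕ} [NeZero M] (a : Fin d → ZMod M) (y : Lattice d) :
    ∃ x, residue M x = a ∧ y ∈ cubeAt M x := by
  have hM : (0 : ℤ) < M := by exact_mod_cast Nat.pos_of_ne_zero (NeZero.ne M)
  refine ⟨fun i => (a i).val + M * ((y i - (a i).val) / M), ?_, mem_cubeAt.2 fun i => ?_⟩
  · ext i
    simp [residue]
  · have h1 := Int.mul_ediv_add_emod (y i - (a i).val) M
    have h2 := Int.emod_nonneg (y i - (a i).val) hM.ne'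
    have h3 := Int.emod_lt_of_pos (y i - (a i).val) hM
    constructor <;> linarith

open Classical in
/-- The lower corners of the cubes of side `M` contained in `Q`. -/
def corners (M : ℕ) (Q : Finset (Lattice d)) : Finset (Lattice d) :=
  Q.filter fun x => cubeAt M x ⊆ Q

theorem cubeAt_subset_of_mem_corners {M : ℕ} {Q : Finset (Lattice d)} {x : Lattice d}
    (hx : x ∈ corners M Q) : cubeAt M x ⊆ Q := by
  classical exact (Finset.mem_filter.1 hx).2

theorem card_corners_le (M : ℕ) (Q : Finset (Lattice d)) : (corners M Q).card ≤ Q.card := by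
  classical exact Finset.card_filter_le _ _

/-- The corners in a fixed class modulo `M`: the cubes at these points are disjoint. -/
def tiling (M : ℕ) (Q : Finset (Lattice d)) (a : Fin d → ZMod M) : Finset (Lattice d) :=
  (corners M Q).filter fun x => residue M x = a

theorem mem_tiling {M : ℕ} {Q : Finset (Lattice d)} {a : Fin d → ZMod M} {x : Lattice d} :
    x ∈ tiling M Q a ↔ x ∈ corners M Q ∧ residue M x = a := Finset.mem_filter

theorem disjoint_cubeAt_of_mem_tiling {M : ℕ} {Q : Finset (Lattice d)} {a : Fin d → ZMod M}
    {x y : Lattice d} (hx : x ∈ tiling M Q a) (hy : y ∈ tiling M Q a) (hne : x ≠ y) :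
    Disjoint (cubeAt M x) (cubeAt M y) :=
  disjoint_cubeAt ((mem_tiling.1 hx).2.trans (mem_tiling.1 hy).2.symm) hne

theorem biUnion_core_subset (r M : ℕ) (Q : Finset (Lattice d)) (a : Fin d → ZMod M) :
    ((tiling M Q a).biUnion fun x => core r (cubeAt M x)) ⊆ Q :=
  Finset.biUnion_subset.2 fun _ hx => (core_subset r _).trans
    (cubeAt_subset_of_mem_corners (mem_tiling.1 hx).1)

/-- A point of `Q` that is missed lies either in a grid cube leaving `Q`, hence within `M` of the
complement, or in the `r`-collar of a grid cube inside `Q`. -/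
theorem card_sdiff_biUnion_core_le (r M : ℕ) [NeZero M] (Q : Finset (Lattice d))
    (a : Fin d → ZMod M) :
    (Q \ (tiling M Q a).biUnion fun x => core r (cubeAt M x)).card ≤
      (boundary M Q).ncard + (tiling M Q a).card * (boundary r (cube d M)).ncard := by
  classical
  have hsub : (Q \ (tiling M Q a).biUnion fun x => core r (cubeAt M x)) ⊆
      (finite_boundary M Q).toFinset ∪
        (tiling M Q a).biUnion fun x => cubeAt M x \ core r (cubeAt M x) := by
    intro y hy
    obtain ⟨hyQ, hy⟩ := Finset.mem_sdiff.1 hy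
    obtain ⟨x, hxa, hyx⟩ := exists_residue_eq a y
    by_cases hx : cubeAt M x ⊆ Q
    · have hxt : x ∈ tiling M Q a := mem_tiling.2
        ⟨Finset.mem_filter.2 ⟨hx (self_mem_cubeAt (Nat.pos_of_ne_zero (NeZero.ne M)) x), hx⟩, hxa⟩
      refine Finset.mem_union_right _ (Finset.mem_biUnion.2 ⟨x, hxt, ?_⟩)
      exact Finset.mem_sdiff.2 ⟨hyx, fun h => hy (Finset.mem_biUnion.2 ⟨x, hxt, h⟩)⟩
    · obtain ⟨z, hzx, hzQ⟩ := Finset.not_subset.1 hx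
      refine Finset.mem_union_left _ ((finite_boundary M Q).mem_toFinset.2
        (Or.inr ⟨hyQ, z, hzQ, dist_le_natCast.2 fun i => ?_⟩))
      have h1 := mem_cubeAt.1 hyx i
      have h2 := mem_cubeAt.1 hzx i
      exact abs_le.2 ⟨by omega, by omega⟩
  refine (Finset.card_le_card hsub).trans ((Finset.card_union_le _ _).trans (add_le_add ?_ ?_))
  · rw [Set.ncard_eq_toFinset_card _ (finite_boundary M Q)]
  · exact Finset.card_biUnion_le_card_mul _ _ _ fun x _ => card_cubeAt_sdiff_core_le r M x

theorem sum_tiling (M : ℕ) [NeZero M] (Q : Finset (Lattice d)) (g : Lattice d → ℕ) :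
    ∑ a : Fin d → ZMod M, ∑ x ∈ tiling M Q a, g x = ∑ x ∈ corners M Q, g x :=
  Finset.sum_fiberwise _ _ _

theorem sum_card_tiling (M : ℕ) [NeZero M] (Q : Finset (Lattice d)) :
    ∑ a : Fin d → ZMod M, (tiling M Q a).card = (corners M Q).card := by
  simpa using sum_tiling M Q fun _ => 1

/-- The boundary lies in the shell between the cube enlarged by `r` and the cube shrunk by `r` on
every side; truncated subtraction takes care of small `M`. -/
theorem boundary_cube_ncard_le (r M : ℕ) :
    (boundary r (cube d M)).ncard + (M - 2 * r) ^ d ≤ (M + 2 * r) ^ d := by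
  have hsub : cubeAt (M - 2 * r) (fun _ : Fin d => (r : ℤ)) ⊆
      cubeAt (M + 2 * r) (fun _ : Fin d => -(r : ℤ)) := fun x hx => mem_cubeAt.2 fun i => by
    have := mem_cubeAt.1 hx i
    omega
  rw [← card_cubeAt (M - 2 * r) (fun _ : Fin d => (r : ℤ)),
    ← card_cubeAt (M + 2 * r) (fun _ : Fin d => -(r : ℤ)),
    ← Finset.card_sdiff_add_card_eq_card hsub, ← Set.ncard_coe_finset (_ \ _)]
  refine Nat.add_le_add_right (Set.ncard_le_ncard ?_ (Finset.finite_toSet _)) _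
  rintro x hx
  rw [Finset.mem_coe, Finset.mem_sdiff]
  rcases hx with ⟨hx, y, hy, hxy⟩ | ⟨hx, y, hy, hxy⟩
  · rw [dist_le_natCast] at hxy
    refine ⟨mem_cubeAt.2 fun i => ?_, fun h => hx (mem_cubeAt.2 fun i => ?_)⟩
    · have h1 := abs_le.1 (hxy i)
      have h2 := mem_cubeAt.1 hy i
      simp only [Pi.zero_apply] at h2
      omega
    · have h1 := mem_cubeAt.1 h i
      simp only [Pi.zero_apply]
      omega
  · rw [dist_le_natCast] at hxy
    refine ⟨mem_cubeAt.2 fun i => ?_, fun h => hy (mem_cubeAt.2 fun i => ?_)⟩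
    · have h2 := mem_cubeAt.1 hx i
      simp only [Pi.zero_apply] at h2
      omega
    · have h1 := mem_cubeAt.1 h i
      have h2 := abs_le.1 (hxy i)
      simp only [Pi.zero_apply]
      omega

theorem tendsto_boundary_cube (d r : ℕ) :
    Tendsto (fun M : ℕ => ((boundary r (cube d M)).ncard : ℝ) / ((cube d M).card : ℝ))
      atTop (𝓝 0) := by
  have hinv : Tendsto (fun M : ℕ => (2 * r : ℝ) / M) atTop (𝓝 0) :=
    tendsto_const_div_atTop_nhds_zero_nat _
  have hlim : Tendsto (fun M : ℕ => (1 + (2 * r : ℝ) / M) ^ d - (1 - (2 * r : ℝ) / M) ^ d)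
      atTop (𝓝 0) := by
    simpa using ((hinv.const_add 1).pow d).sub ((hinv.const_sub 1).pow d)
  refine squeeze_zero' (Eventually.of_forall fun M => by positivity) ?_ hlim
  filter_upwards [eventually_ge_atTop (2 * r + 1)] with M hM
  have hM0 : (0 : ℝ) < M := by exact_mod_cast (by omega : 0 < M)
  have h := boundary_cube_ncard_le (d := d) r M
  have h' : ((boundary r (cube d M)).ncard : ℝ) + ((M : ℝ) - 2 * r) ^ d ≤ (M + 2 * r) ^ d := by
    have := (Nat.cast_le (α := ℝ)).2 h
    push_cast [Nat.cast_sub (by omega : 2 * r ≤ M)] at this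
    exact this
  rw [cube, card_cubeAt, Nat.cast_pow, ← cube, div_le_iff₀ (by positivity), sub_mul, ← mul_pow,
    ← mul_pow, add_mul, sub_mul, div_mul_cancel₀ _ hM0.ne', one_mul]
  linarith

end Geometry

/-! ### Approximating the count by pattern blocks -/

section BlockApproximation

open Module

variable {d : ℕ} {A : Type*} {𝓗 : Type*} [NormedAddCommGroup 𝓗] [InnerProductSpace ℂ 𝓗]
  [FiniteDimensional ℂ 𝓗] [CompleteSpace 𝓗] {H : L2 d 𝓗 →L[ℂ] L2 d 𝓗} (hH : IsSelfAdjoint H)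
  (Λ : Lattice d → A)

omit [FiniteDimensional ℂ 𝓗] [CompleteSpace 𝓗] in
theorem IsInvariantWith.mono {r R : ℕ} (hinv : IsInvariantWith Λ H r) (hrR : r ≤ R) :
    IsInvariantWith Λ H R := by
  have hsub : ∀ x : Lattice d, cubeAt r x ⊆ cubeAt R x := fun x y hy => mem_cubeAt.2 fun i => by
    have := mem_cubeAt.1 hy i
    omega
  exact fun x y t h => hinv x y t fun z hz =>
    h z (Finset.union_subset_union (hsub x) (hsub y) hz)

omit [FiniteDimensional ℂ 𝓗] [CompleteSpace 𝓗] in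
theorem HasRange.mono {r R : ℕ} (hr : HasRange H r) (hrR : r ≤ R) : HasRange H R :=
  fun x y h => hr x y (lt_of_le_of_lt (by exact_mod_cast hrR) h)

/-- The pattern of `Λ` on the cube of side `M` at `x`. -/
def patternAt (M : ℕ) (x : Lattice d) : cube d M → A := fun z => Λ (x + z)

theorem occursAt_iff {M : ℕ} {p : cube d M → A} {x : Lattice d} :
    (⟨cube d M, p⟩ : Pattern d A).OccursAt Λ x ↔ patternAt Λ M x = p :=
  funext_iff.symm

/-- For `y` in the `R`-core the cube `C_R(y)` stays inside the big cube, so the pattern there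
determines every matrix entry between core points. -/
theorem volumeCount_core_cubeAt {R M : ℕ} (hinv : IsInvariantWith Λ H R) {x x' : Lattice d}
    (h : patternAt Λ M x = patternAt Λ M x') (l : ℝ) :
    volumeCount hH (core R (cubeAt M x)) l = volumeCount hH (core R (cubeAt M x')) l := by
  obtain ⟨t, rfl⟩ : ∃ t, x' = x + t := ⟨x' - x, by simp⟩
  have hmem : ∀ y ∈ core R (cubeAt M x), ∀ z ∈ cubeAt R y, z ∈ cubeAt M x := by
    intro y hy z hz
    refine mem_core.1 hy z (dist_le_natCast.2 fun i => ?_)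
    have := mem_cubeAt.1 hz i
    exact abs_le.2 ⟨by omega, by omega⟩
  rw [cubeAt_add, core_translate]
  refine (volumeCount_translate hH (fun y hy y' hy' => hinv y y' t fun z hz => ?_) l).symm
  have hzx : z ∈ cubeAt M x := (Finset.mem_union.1 hz).elim (hmem y hy z) (hmem y' hy' z)
  have hz0 : z - x ∈ cube d M := by
    change z - x ∈ cubeAt M 0
    rwa [← mem_translate, ← cubeAt_add, zero_add]
  have := congrFun h ⟨z - x, hz0⟩
  simp only [patternAt] at this
  rw [add_sub_cancel, add_right_comm, add_sub_cancel] at this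
  exact this.symm

open Classical in
/-- The eigenvalue counting function of `H` on the core of a cube on which `Λ` has the pattern
`p`. -/
def blockCount (R M : ℕ) (p : cube d M → A) (l : ℝ) : ℕ :=
  -- The value `0` for a pattern that never occurs is harmless: such a pattern has count zero in
  -- every volume.
  if h : ∃ x, patternAt Λ M x = p then volumeCount hH (core R (cubeAt M h.choose)) l else 0

theorem blockCount_patternAt {R M : ℕ} (hinv : IsInvariantWith Λ H R) (x : Lattice d) (l : ℝ) :
    blockCount hH Λ R M (patternAt Λ M x) l = volumeCount hH (core R (cubeAt M x)) l := by
  have h : ∃ y, patternAt Λ M y = patternAt Λ M x := ⟨x, rfl⟩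
  rw [blockCount, dif_pos h]
  exact volumeCount_core_cubeAt hH Λ hinv h.choose_spec l

theorem blockCount_le (R M : ℕ) (p : cube d M → A) (l : ℝ) :
    blockCount hH Λ R M p l ≤ (cube d M).card * finrank ℂ 𝓗 := by
  rw [blockCount]
  split_ifs with h
  · refine (volumeCount_le hH _ l).trans (Nat.mul_le_mul_right _ ?_)
    exact (Finset.card_le_card (core_subset _ _)).trans_eq
      ((card_cubeAt M _).trans (card_cubeAt M 0).symm)
  · exact Nat.zero_le _

theorem count_eq_card_filter [DecidableEq A] {M : ℕ} (Q : Finset (Lattice d)) (p : cube d M → A) :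
    (⟨cube d M, p⟩ : Pattern d A).count Λ Q =
      ((corners M Q).filter fun x => patternAt Λ M x = p).card := by
  classical
  rw [Pattern.count, corners, Finset.filter_filter]
  congr 1
  refine Finset.filter_congr fun x _ => ?_
  rw [occursAt_iff]
  refine and_congr_left fun _ => ?_
  rw [← zero_add x, cubeAt_add]
  simp only [Finset.subset_iff, mem_translate, zero_add]
  constructor
  · intro h y hy
    simpa using h (y - x) hy
  · intro h z hz
    refine h ?_
    rw [add_sub_cancel_left]
    exact hz

variable [Fintype A]

theorem sum_volumeCount_corners {R M : ℕ} (hinv : IsInvariantWith Λ H R)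
    (Q : Finset (Lattice d)) (l : ℝ) :
    ∑ x ∈ corners M Q, volumeCount hH (core R (cubeAt M x)) l =
      ∑ p : cube d M → A, (⟨cube d M, p⟩ : Pattern d A).count Λ Q * blockCount hH Λ R M p l := by
  classical
  rw [← Finset.sum_fiberwise _ (patternAt Λ M)]
  refine Finset.sum_congr rfl fun p _ => ?_
  rw [count_eq_card_filter, ← smul_eq_mul, ← Finset.sum_const]
  refine Finset.sum_congr rfl fun x hx => ?_
  rw [← blockCount_patternAt hH Λ hinv, (Finset.mem_filter.1 hx).2]

/-- For each of the `|C_M|` grid positions, the union of the cores is a subset of `Q` with additive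
count and small complement. Summing over the positions, rather than fixing one, turns the sum over
grid cubes into pattern counts. -/
theorem sum_count_mul_blockCount_le {R M : ℕ} (hM : 1 ≤ M) (hfr : HasRange H R)
    (hinv : IsInvariantWith Λ H R) (Q : Finset (Lattice d)) (l : ℝ) :
    ∑ p : cube d M → A, (⟨cube d M, p⟩ : Pattern d A).count Λ Q * blockCount hH Λ R M p l ≤
        (cube d M).card * volumeCount hH Q l ∧
      (cube d M).card * volumeCount hH Q l ≤
        ∑ p : cube d M → A, (⟨cube d M, p⟩ : Pattern d A).count Λ Q * blockCount hH Λ R M p l +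
          ((cube d M).card * (boundary M Q).ncard + Q.card * (boundary R (cube d M)).ncard) *
            finrank ℂ 𝓗 := by
  have : NeZero M := ⟨by omega⟩
  have hcard : (cube d M).card = (Finset.univ : Finset (Fin d → ZMod M)).card := by
    rw [cube, card_cubeAt, Finset.card_univ, Fintype.card_fun, ZMod.card, Fintype.card_fin]
  have hunion (a : Fin d → ZMod M) := volumeCount_biUnion hH hfr (tiling M Q a)
    (fun x => core R (cubeAt M x)) (fun x hx y hy hne u hu v hv =>
      disjoint_core_dist (disjoint_cubeAt_of_mem_tiling hx hy hne) hu hv) l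
  rw [← sum_volumeCount_corners hH Λ hinv, ← sum_tiling M Q]
  constructor
  · rw [hcard, ← smul_eq_mul, ← Finset.sum_const]
    refine Finset.sum_le_sum fun a _ => ?_
    rw [← hunion]
    exact volumeCount_mono_set hH (biUnion_core_subset R M Q a) l
  · calc (cube d M).card * volumeCount hH Q l
        = ∑ _a : Fin d → ZMod M, volumeCount hH Q l := by
          rw [hcard, Finset.sum_const, smul_eq_mul]
      _ ≤ ∑ a : Fin d → ZMod M, (∑ x ∈ tiling M Q a, volumeCount hH (core R (cubeAt M x)) l +
            ((boundary M Q).ncard + (tiling M Q a).card * (boundary R (cube d M)).ncard) *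
              finrank ℂ 𝓗) := by
          refine Finset.sum_le_sum fun a _ => ?_
          rw [← hunion]
          exact (volumeCount_le_add hH (biUnion_core_subset R M Q a) l).trans
            (Nat.add_le_add_left (Nat.mul_le_mul_right _ (card_sdiff_biUnion_core_le R M Q a)) _)
      _ = ∑ a : Fin d → ZMod M, ∑ x ∈ tiling M Q a, volumeCount hH (core R (cubeAt M x)) l +
            ((cube d M).card * (boundary M Q).ncard +
              (corners M Q).card * (boundary R (cube d M)).ncard) * finrank ℂ 𝓗 := by
          rw [Finset.sum_add_distrib, ← Finset.sum_mul, Finset.sum_add_distrib, ← Finset.sum_mul,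
            sum_card_tiling, Finset.sum_const, ← hcard, smul_eq_mul]
      _ ≤ _ := by
          have := card_corners_le M Q
          gcongr

/-- The approximation of the density of states by blocks of side `M`. -/
def blockAverage (R M : ℕ) (ν : Pattern d A → ℝ) (l : ℝ) : ℝ :=
  ∑ p : cube d M → A,
    ν ⟨cube d M, p⟩ * ((blockCount hH Λ R M p l : ℝ) / ((cube d M).card * finrank ℂ 𝓗))

/-- The right side is independent of `l`, which makes the convergence uniform. Replacing empirical
frequencies by `ν` costs only the sum of their differences, as each normalised block count is at
most `1`. -/
theorem abs_normalisedCount_sub_blockAverage_le [Nontrivial 𝓗] {R M : ℕ} (hM : 1 ≤ M)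
    (hfr : HasRange H R) (hinv : IsInvariantWith Λ H R) (ν : Pattern d A → ℝ)
    {Q : Finset (Lattice d)} (hQ : Q.Nonempty) (l : ℝ) :
    |normalisedCount hH Q l - blockAverage hH Λ R M ν l| ≤
      ((boundary R (cube d M)).ncard : ℝ) / ((cube d M).card : ℝ)
      + ∑ p : cube d M → A,
          |((⟨cube d M, p⟩ : Pattern d A).count Λ Q : ℝ) / (Q.card : ℝ) - ν ⟨cube d M, p⟩|
      + ((boundary M Q).ncard : ℝ) / (Q.card : ℝ) := by
  obtain ⟨h1, h2⟩ := sum_count_mul_blockCount_le hH Λ hM hfr hinv Q l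
  have h3 (p : cube d M → A) := (Nat.cast_le (α := ℝ)).2 (blockCount_le hH Λ R M p l)
  rw [← Nat.cast_le (α := ℝ)] at h1 h2
  simp only [Nat.cast_mul, Nat.cast_add] at h1 h2 h3
  have hq : (0 : ℝ) < Q.card := by exact_mod_cast hQ.card_pos
  have hD : (0 : ℝ) < finrank ℂ 𝓗 := by exact_mod_cast finrank_pos
  have hc : (0 : ℝ) < (cube d M).card := by
    have : 0 < (cube d M).card := Finset.card_pos.2 ⟨0, self_mem_cubeAt hM 0⟩
    exact_mod_cast this
  set c : ℝ := (((cube d M).card : ℕ) : ℝ)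
  set D : ℝ := ((finrank ℂ 𝓗 : ℕ) : ℝ)
  set q : ℝ := ((Q.card : ℕ) : ℝ)
  -- `X` is the block average formed with the empirical frequencies in `Q`.
  set X : ℝ := ∑ p : cube d M → A, ((⟨cube d M, p⟩ : Pattern d A).count Λ Q : ℝ) / q *
    ((blockCount hH Λ R M p l : ℝ) / (c * D)) with hX
  have hXeq : X = ((∑ p : cube d M → A, (⟨cube d M, p⟩ : Pattern d A).count Λ Q *
      blockCount hH Λ R M p l : ℕ) : ℝ) / (q * (c * D)) := by
    rw [hX, Nat.cast_sum, Finset.sum_div]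
    refine Finset.sum_congr rfl fun p _ => ?_
    rw [Nat.cast_mul, div_mul_div_comm]
  have hN : normalisedCount hH Q l = c * (volumeCount hH Q l : ℝ) / (q * (c * D)) := by
    change (volumeCount hH Q l : ℝ) / (q * D) = _
    field_simp
  have hlow : X ≤ normalisedCount hH Q l := by
    rw [hXeq, hN]
    refine div_le_div_of_nonneg_right ?_ (by positivity)
    exact h1
  have hup : normalisedCount hH Q l ≤
      X + ((boundary M Q).ncard / q + (boundary R (cube d M)).ncard / c) := by
    rw [hXeq, hN, show ((boundary M Q).ncard : ℝ) / q + (boundary R (cube d M)).ncard / c =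
      ((c * (boundary M Q).ncard + q * (boundary R (cube d M)).ncard) * D) / (q * (c * D)) by
        field_simp, ← add_div]
    refine div_le_div_of_nonneg_right ?_ (by positivity)
    exact h2
  have hXL : |X - blockAverage hH Λ R M ν l| ≤ ∑ p : cube d M → A,
      |((⟨cube d M, p⟩ : Pattern d A).count Λ Q : ℝ) / q - ν ⟨cube d M, p⟩| := by
    rw [hX, blockAverage, ← Finset.sum_sub_distrib]
    refine (Finset.abs_sum_le_sum_abs _ _).trans (Finset.sum_le_sum fun p _ => ?_)
    rw [← sub_mul, abs_mul]
    refine mul_le_of_le_one_right (abs_nonneg _) ?_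
    rw [abs_of_nonneg (by positivity)]
    refine div_le_one_of_le₀ ?_ (by positivity)
    exact h3 p
  have hXL' := abs_le.1 hXL
  have hb : 0 ≤ ((boundary M Q).ncard : ℝ) / q := by positivity
  have hb' : 0 ≤ ((boundary R (cube d M)).ncard : ℝ) / c := by positivity
  exact abs_le.2 ⟨by linarith, by linarith⟩

end BlockApproximation

/-! ### The limit distribution and the error estimate -/

section Limit

open Module

theorem abs_re_inner_le {d : ℕ} {𝓗 : Type*} [NormedAddCommGroup 𝓗] [InnerProductSpace ℂ 𝓗]
    (H : L2 d 𝓗 →L[ℂ] L2 d 𝓗) (u : L2 d 𝓗) : |(inner ℂ (H u) u).re| ≤ ‖H‖ * ‖u‖ ^ 2 :=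
  calc |(inner ℂ (H u) u).re| ≤ ‖inner ℂ (H u) u‖ := Complex.abs_re_le_norm _
    _ ≤ ‖H u‖ * ‖u‖ := norm_inner_le_norm _ _
    _ ≤ ‖H‖ * ‖u‖ * ‖u‖ := by gcongr; exact H.le_opNorm u
    _ = ‖H‖ * ‖u‖ ^ 2 := by ring

theorem isBoxAtOrigin_cube {d : ℕ} {A : Type*} {M : ℕ} (hM : 1 ≤ M) (p : cube d M → A) :
    (⟨cube d M, p⟩ : Pattern d A).IsBoxAtOrigin :=
  ⟨fun _ => 0 + (M : ℤ) - 1, fun i => by simp only [Pi.zero_apply]; omega, rfl⟩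

variable {d : ℕ} {𝓗 : Type*} [NormedAddCommGroup 𝓗] [InnerProductSpace ℂ 𝓗]
  [FiniteDimensional ℂ 𝓗] [CompleteSpace 𝓗] {H : L2 d 𝓗 →L[ℂ] L2 d 𝓗} (hH : IsSelfAdjoint H)

theorem normalisedCount_eq (Q : Finset (Lattice d)) (t : ℝ) :
    normalisedCount hH Q t = (volumeCount hH Q t : ℝ) / ((Q.card : ℝ) * (finrank ℂ 𝓗 : ℝ)) := rfl

theorem monotone_normalisedCount (Q : Finset (Lattice d)) : Monotone (normalisedCount hH Q) := by
  intro s t hst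
  refine div_le_div_of_nonneg_right ?_ (by positivity)
  rw [Nat.cast_le]
  refine Finset.card_le_card fun k hk => ?_
  simp only [Finset.mem_filter, Finset.mem_univ, true_and] at hk ⊢
  exact hk.trans hst

/-- There are finitely many eigenvalues and they are counted with `≤`, so the function is constant
just to the right of `t`. -/
theorem continuousWithinAt_normalisedCount (Q : Finset (Lattice d)) (t : ℝ) :
    ContinuousWithinAt (normalisedCount hH Q) (Set.Ici t) t := by
  refine (continuousWithinAt_const (b := normalisedCount hH Q t)).congr_of_eventuallyEq ?_ rfl
  have h : ∀ᶠ s in 𝓝[≥] t, ∀ k, (compression_isSymmetric hH Q).eigenvalues rfl k ≤ s ↔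
      (compression_isSymmetric hH Q).eigenvalues rfl k ≤ t := by
    refine eventually_all.2 fun k => ?_
    by_cases hk : (compression_isSymmetric hH Q).eigenvalues rfl k ≤ t
    · filter_upwards [self_mem_nhdsWithin] with s hs
      exact ⟨fun _ => hk, fun h => h.trans hs⟩
    · filter_upwards [nhdsWithin_le_nhds (Iio_mem_nhds (not_le.1 hk))] with s hs
      exact ⟨fun h => absurd hs h.not_gt, fun h => absurd h hk⟩
  filter_upwards [h] with s hs
  simp only [normalisedCount, eigenvalueCount, hs]

theorem normalisedCount_eq_one [Nontrivial 𝓗] {Q : Finset (Lattice d)} (hQ : Q.Nonempty) {t : ℝ}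
    (ht : ‖H‖ ≤ t) : normalisedCount hH Q t = 1 := by
  have h : volumeCount hH Q t = Q.card * finrank ℂ 𝓗 := by
    refine le_antisymm (volumeCount_le hH Q t) ?_
    rw [← finrank_supportedIn]
    refine finrank_le_volumeCount hH le_rfl fun u _ => ?_
    exact (le_abs_self _).trans ((abs_re_inner_le H u).trans (by gcongr))
  have hq : (0 : ℝ) < Q.card := by exact_mod_cast hQ.card_pos
  have hD : (0 : ℝ) < finrank ℂ 𝓗 := by exact_mod_cast finrank_pos
  rw [normalisedCount_eq, h, Nat.cast_mul, div_self (by positivity)]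

theorem normalisedCount_eq_zero (Q : Finset (Lattice d)) {t : ℝ} (ht : t < -‖H‖) :
    normalisedCount hH Q t = 0 := by
  have h : volumeCount hH Q t = 0 := by
    have := finrank_add_volumeCount_le hH (Q := Q) (t := t) le_rfl fun u _ hu => by
      refine lt_of_lt_of_le ?_ (abs_le.1 (abs_re_inner_le H u)).1
      rw [← neg_mul]
      have := norm_pos_iff.2 hu
      gcongr
    rw [finrank_supportedIn] at this
    omega
  rw [normalisedCount_eq, h, Nat.cast_zero, zero_div]

/-- Uniform limits keep monotonicity and right continuity. No mass escapes, since every count is `0`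
below `-‖H‖` and `1` from `‖H‖` on. -/
theorem exists_isDensityOfStates [Nontrivial 𝓗] {Q : ℕ → Finset (Lattice d)}
    (hQ : ∀ j, (Q j).Nonempty) {N : ℝ → ℝ}
    (hN : TendstoUniformly (fun j => normalisedCount hH (Q j)) N atTop) :
    ∃ μ : ProbabilityMeasure ℝ, IsDensityOfStates hH Q μ := by
  have hlim (t : ℝ) : Tendsto (fun j => normalisedCount hH (Q j) t) atTop (𝓝 (N t)) :=
    hN.tendsto_at t
  let f : StieltjesFunction ℝ :=
    { toFun := N
      mono' := fun s t hst =>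
        le_of_tendsto_of_tendsto' (hlim s) (hlim t) fun j => monotone_normalisedCount hH (Q j) hst
      right_continuous' := fun t => by
        refine continuousWithinAt_of_locally_uniform_approx_of_continuousWithinAt
          Set.self_mem_Ici fun u hu => ?_
        obtain ⟨j, hj⟩ := (hN u hu).exists
        exact ⟨Set.univ, univ_mem, normalisedCount hH (Q j),
          continuousWithinAt_normalisedCount hH (Q j) t, fun y _ => hj y⟩ }
  have hbot : Tendsto f atBot (𝓝 0) := by
    refine tendsto_const_nhds.congr' ?_
    filter_upwards [eventually_lt_atBot (-‖H‖)] with t ht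
    refine tendsto_nhds_unique ?_ (hlim t)
    simp [normalisedCount_eq_zero hH _ ht]
  have htop : Tendsto f atTop (𝓝 1) := by
    refine tendsto_const_nhds.congr' ?_
    filter_upwards [eventually_ge_atTop ‖H‖] with t ht
    refine tendsto_nhds_unique ?_ (hlim t)
    simp [normalisedCount_eq_one hH (hQ _) ht]
  refine ⟨⟨f.measure, f.isProbabilityMeasure hbot htop⟩, ?_⟩
  have hcdf := ProbabilityTheory.cdf_measure_stieltjesFunction f hbot htop
  change TendstoUniformly _ (fun t => ProbabilityTheory.cdf f.measure t) atTop
  rw [hcdf]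
  exact hN

theorem IsDensityOfStates.unique {Q : ℕ → Finset (Lattice d)} {μ μ' : ProbabilityMeasure ℝ}
    (h : IsDensityOfStates hH Q μ) (h' : IsDensityOfStates hH Q μ') : μ = μ' := by
  refine Subtype.ext (Measure.eq_of_cdf (μ : Measure ℝ) (μ' : Measure ℝ) (StieltjesFunction.ext fun t => ?_))
  exact tendsto_nhds_unique (h.tendsto_at t) (h'.tendsto_at t)

variable {A : Type*} [Fintype A] {Λ : Lattice d → A} {Q : ℕ → Finset (Lattice d)}
  {ν : Pattern d A → ℝ} {R : ℕ}

theorem tendsto_pattern_error (hQ : IsVanHove Q)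
    (hν : ∀ P : Pattern d A, P.IsBoxAtOrigin → HasFrequency Λ Q P (ν P)) {M : ℕ} (hM : 1 ≤ M)
    (b : ℝ) :
    Tendsto (fun j => b + ∑ p : cube d M → A,
        |((⟨cube d M, p⟩ : Pattern d A).count Λ (Q j) : ℝ) / ((Q j).card : ℝ) - ν ⟨cube d M, p⟩|
      + ((boundary M (Q j)).ncard : ℝ) / ((Q j).card : ℝ)) atTop (𝓝 b) := by
  have h1 : Tendsto (fun j => ∑ p : cube d M → A,
      |((⟨cube d M, p⟩ : Pattern d A).count Λ (Q j) : ℝ) / ((Q j).card : ℝ) - ν ⟨cube d M, p⟩|)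
      atTop (𝓝 0) := by
    rw [← Finset.sum_const_zero (s := (Finset.univ : Finset (cube d M → A)))]
    refine tendsto_finsetSum _ fun p _ => ?_
    have := ((hν _ (isBoxAtOrigin_cube hM p)).sub_const (ν ⟨cube d M, p⟩)).abs
    simpa using this
  simpa using (h1.const_add b).add (hQ.2 M)

theorem exists_tendstoUniformly_normalisedCount [Nontrivial 𝓗] (hQ : IsVanHove Q)
    (hν : ∀ P : Pattern d A, P.IsBoxAtOrigin → HasFrequency Λ Q P (ν P))
    (hfr : HasRange H R) (hinv : IsInvariantWith Λ H R) :
    ∃ N : ℝ → ℝ, TendstoUniformly (fun j => normalisedCount hH (Q j)) N atTop := by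
  have hcauchy : UniformCauchySeqOn (fun j => normalisedCount hH (Q j)) atTop Set.univ := by
    refine Metric.uniformCauchySeqOn_iff.2 fun ε hε => ?_
    -- The block average for one fixed `M` is a common reference for both indices, each of which may
    -- deviate from it by less than `ε / 2`.
    obtain ⟨M, hMε, hM⟩ := (((tendsto_boundary_cube d R).eventually_lt_const (half_pos hε)).and
      (eventually_ge_atTop 1)).exists
    obtain ⟨J, hJ⟩ := eventually_atTop.1 ((tendsto_pattern_error hQ hν hM _).eventually_lt_const
      hMε)
    refine ⟨J, fun m hm n hn t _ => ?_⟩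
    have h1 := abs_normalisedCount_sub_blockAverage_le hH Λ hM hfr hinv ν (hQ.1 m) t
    have h2 := abs_normalisedCount_sub_blockAverage_le hH Λ hM hfr hinv ν (hQ.1 n) t
    rw [← Real.dist_eq] at h1 h2
    have h3 := dist_triangle_right (normalisedCount hH (Q m) t) (normalisedCount hH (Q n) t)
      (blockAverage hH Λ R M ν t)
    linarith [hJ m hm, hJ n hn]
  choose N hN using fun t => cauchySeq_tendsto_of_complete (hcauchy.cauchySeq (Set.mem_univ t))
  exact ⟨N, tendstoUniformlyOn_univ.1
    (hcauchy.tendstoUniformlyOn_of_tendsto fun t _ => hN t)⟩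

theorem abs_cdf_sub_blockAverage_le [Nontrivial 𝓗] (hQ : IsVanHove Q)
    (hν : ∀ P : Pattern d A, P.IsBoxAtOrigin → HasFrequency Λ Q P (ν P))
    (hfr : HasRange H R) (hinv : IsInvariantWith Λ H R) {μ : ProbabilityMeasure ℝ}
    (hμ : IsDensityOfStates hH Q μ) {M : ℕ} (hM : 1 ≤ M) (t : ℝ) :
    |ProbabilityTheory.cdf (μ : Measure ℝ) t - blockAverage hH Λ R M ν t| ≤
      ((boundary R (cube d M)).ncard : ℝ) / ((cube d M).card : ℝ) :=
  le_of_tendsto_of_tendsto' ((hμ.tendsto_at t).sub_const _).abs (tendsto_pattern_error hQ hν hM _)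
    fun j => abs_normalisedCount_sub_blockAverage_le hH Λ hM hfr hinv ν (hQ.1 j) t

/-- If `H` is diagonal and invariant under all translations, then the normalised counting
function does not depend on the volume. -/
theorem normalisedCount_eq_of_invariant (hfr : HasRange H 0)
    (hinv : ∀ x y t : Lattice d, ∀ v, entry H y x v = entry H (y + t) (x + t) v)
    {Q : Finset (Lattice d)} (hQ : Q.Nonempty) (l : ℝ) :
    normalisedCount hH Q l = (volumeCount hH {0} l : ℝ) / (finrank ℂ 𝓗 : ℝ) := by
  have h0 (x : Lattice d) : volumeCount hH {x} l = volumeCount hH {0} l := by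
    rw [← volumeCount_translate hH (B := {0}) (t := x) fun y _ z _ => hinv y z x]
    simp [translate]
  have h := volumeCount_biUnion hH hfr Q (fun x => {x}) (fun x _ y _ hne u hu v hv => by
    rw [Finset.mem_singleton.1 hu, Finset.mem_singleton.1 hv, Nat.cast_zero]
    exact dist_pos.2 hne) l
  rw [Finset.biUnion_singleton_eq_self] at h
  simp only [h0, Finset.sum_const, smul_eq_mul] at h
  have hq : (0 : ℝ) < Q.card := by exact_mod_cast hQ.card_pos
  rw [normalisedCount_eq, h, Nat.cast_mul, mul_div_mul_left _ _ hq.ne']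

theorem abs_normalisedCount_sub_cdf_le [Nontrivial 𝓗] (hQ : IsVanHove Q)
    (hν : ∀ P : Pattern d A, P.IsBoxAtOrigin → HasFrequency Λ Q P (ν P))
    (hfr : HasRange H R) (hinv : IsInvariantWith Λ H R) {μ : ProbabilityMeasure ℝ}
    (hμ : IsDensityOfStates hH Q μ) (j : ℕ) {M : ℕ} (hM : 1 ≤ M) (t : ℝ) :
    |normalisedCount hH (Q j) t - ProbabilityTheory.cdf (μ : Measure ℝ) t| ≤
      8 * (((boundary R (cube d M)).ncard : ℝ) / ((cube d M).card : ℝ))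
      + ∑ p : (cube d M → A),
          |((⟨cube d M, p⟩ : Pattern d A).count Λ (Q j) : ℝ) / ((Q j).card : ℝ)
            - ν ⟨cube d M, p⟩|
      + 5 * ((cube d R).card : ℝ) * (((boundary M (Q j)).ncard : ℝ) / ((Q j).card : ℝ)) := by
  have hb : 0 ≤ ((boundary R (cube d M)).ncard : ℝ) / ((cube d M).card : ℝ) := by positivity
  have hβ : 0 ≤ ((boundary M (Q j)).ncard : ℝ) / ((Q j).card : ℝ) := by positivity
  -- If `C_R` is empty, the last term of the bound vanishes and the triangle inequality does not
  -- suffice. But then invariance holds for every translation and `H` is diagonal, so the left side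
  -- is `0`. Otherwise the triangle inequality needs only the factors `2`, `1` and `1`.
  rcases Nat.eq_zero_or_pos (cube d R).card with hR | hR
  · have hempty (x : Lattice d) : cubeAt R x = ∅ := by
      rw [← Finset.card_eq_zero, card_cubeAt, ← card_cubeAt R (0 : Lattice d)]
      exact hR
    have hR0 : R = 0 := by
      rw [cube, card_cubeAt] at hR
      exact eq_zero_of_pow_eq_zero hR
    subst hR0
    have hconst (i : ℕ) := normalisedCount_eq_of_invariant hH hfr
      (fun x y s => hinv x y s (by simp [hempty])) (hQ.1 i) t
    have hlim := hμ.tendsto_at t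
    simp only [hconst] at hlim
    rw [hconst, tendsto_nhds_unique hlim tendsto_const_nhds, sub_self, abs_zero]
    positivity
  · have h1 := abs_normalisedCount_sub_blockAverage_le hH Λ hM hfr hinv ν (hQ.1 j) t
    have h2 := abs_cdf_sub_blockAverage_le hH hQ hν hfr hinv hμ hM t
    have h3 : |normalisedCount hH (Q j) t - ProbabilityTheory.cdf (μ : Measure ℝ) t| ≤
        |normalisedCount hH (Q j) t - blockAverage hH Λ R M ν t| +
          |ProbabilityTheory.cdf (μ : Measure ℝ) t - blockAverage hH Λ R M ν t| := by
      rw [abs_sub_comm (ProbabilityTheory.cdf (μ : Measure ℝ) t)]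
      exact abs_sub_le _ _ _
    have hR' : (1 : ℝ) ≤ (cube d R).card := by exact_mod_cast hR
    have h4 : ((boundary M (Q j)).ncard : ℝ) / ((Q j).card : ℝ) ≤
        5 * ((cube d R).card : ℝ) * (((boundary M (Q j)).ncard : ℝ) / ((Q j).card : ℝ)) :=
      le_mul_of_one_le_left hβ (by linarith)
    linarith

end Limit

/-! ### Approximate eigenvectors and the spectrum -/

section Hilbert

variable {E : Type*} [NormedAddCommGroup E] [InnerProductSpace ℂ E]

/-- Weyl's criterion: a selfadjoint operator that is bounded below after subtraction of a real
number has that number in its resolvent set. -/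
theorem notMem_spectrum_of_le_norm [CompleteSpace E] {H : E →L[ℂ] E} (hH : IsSelfAdjoint H)
    {l ε : ℝ} (hε : 0 < ε) (h : ∀ u, ε * ‖u‖ ≤ ‖H u - (l : ℂ) • u‖) : (l : ℂ) ∉ spectrum ℂ H := by
  rw [spectrum.mem_iff, not_not, ContinuousLinearMap.isUnit_iff_bijective,
    ContinuousLinearMap.bijective_iff_dense_range_and_antilipschitz]
  set T : E →L[ℂ] E := algebraMap ℂ (E →L[ℂ] E) l - H with hT
  have hTu (u : E) : T u = -(H u - (l : ℂ) • u) := by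
    simp [hT, Algebra.algebraMap_eq_smul_one]
  have hbound (u : E) : ε * ‖u‖ ≤ ‖T u‖ := by
    rw [hTu, norm_neg]
    exact h u
  have hsymm (u v : E) : inner ℂ (T u) v = inner ℂ u (T v) := by
    have := ContinuousLinearMap.isSelfAdjoint_iff_isSymmetric.1 hH u v
    rw [ContinuousLinearMap.coe_coe] at this
    rw [hTu, hTu, inner_neg_left, inner_neg_right, inner_sub_left, inner_sub_right,
      inner_smul_left, inner_smul_right, Complex.conj_ofReal, this]
  constructor
  · rw [Submodule.topologicalClosure_eq_top_iff, Submodule.eq_bot_iff]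
    intro x hx
    -- The vector `x` is orthogonal to `T (T x)`; moving one `T` across by symmetry gives `‖T x‖² =
    -- 0`.
    have hx0 : T x = 0 := by
      rw [← inner_self_eq_zero (𝕜 := ℂ), ← hsymm]
      exact hx (T (T x)) ⟨T x, rfl⟩
    have := hbound x
    rw [hx0, norm_zero] at this
    exact norm_le_zero_iff.1 (nonpos_of_mul_nonpos_right this hε)
  · refine ⟨Real.toNNReal ε⁻¹, T.antilipschitz_of_bound fun u => ?_⟩
    rw [Real.coe_toNNReal _ (inv_nonneg.2 hε.le), inv_mul_eq_div, le_div_iff₀ hε, mul_comm]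
    exact hbound u

theorem exists_le_norm_of_notMem_spectrum {H : E →L[ℂ] E} {l : ℝ} (h : (l : ℂ) ∉ spectrum ℂ H) :
    ∃ ε > 0, ∀ u, ε * ‖u‖ ≤ ‖H u - (l : ℂ) • u‖ := by
  rw [spectrum.mem_iff, not_not] at h
  obtain ⟨S, hS⟩ := h.exists_left_inv
  -- Adding `1` keeps the constant positive even if `S = 0`.
  refine ⟨(‖S‖ + 1)⁻¹, by positivity, fun u => ?_⟩
  have hu : u = S (-(H u - (l : ℂ) • u)) := by
    have := congrArg (fun T : E →L[ℂ] E => T u) hS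
    simpa [Algebra.algebraMap_eq_smul_one] using this.symm
  rw [inv_mul_eq_div, div_le_iff₀ (by positivity), mul_comm]
  calc ‖u‖ = ‖S (-(H u - (l : ℂ) • u))‖ := by rw [← hu]
    _ ≤ ‖S‖ * ‖-(H u - (l : ℂ) • u)‖ := S.le_opNorm _
    _ ≤ (‖S‖ + 1) * ‖H u - (l : ℂ) • u‖ := by
      rw [norm_neg]
      gcongr
      linarith

theorem norm_sum_sq_of_inner_eq_zero {ι : Type*} (s : Finset ι) (f : ι → E)
    (h : ∀ i ∈ s, ∀ j ∈ s, i ≠ j → inner ℂ (f i) (f j) = 0) :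
    ‖∑ i ∈ s, f i‖ ^ 2 = ∑ i ∈ s, ‖f i‖ ^ 2 := by
  have key : inner ℂ (∑ i ∈ s, f i) (∑ i ∈ s, f i) = ∑ i ∈ s, inner ℂ (f i) (f i) := by
    rw [sum_inner]
    refine Finset.sum_congr rfl fun i hi => ?_
    rw [inner_sum]
    exact Finset.sum_eq_single i (fun j hj hne => h i hi j hj hne.symm) (fun h => absurd hi h)
  simp only [inner_self_eq_norm_sq_to_K] at key
  exact_mod_cast key

end Hilbert

/-! ### The spectrum as the support of the density of states -/

section Spectrum

open Module

/-- The strict inequality in Weyl's criterion is an open condition, so it survives truncation to a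
large finite set; strictness also keeps the truncation nonzero. -/
theorem exists_supportedIn_norm_le {d : ℕ} {𝓗 : Type*} [NormedAddCommGroup 𝓗]
    [InnerProductSpace ℂ 𝓗] [CompleteSpace 𝓗] {H : L2 d 𝓗 →L[ℂ] L2 d 𝓗} (hH : IsSelfAdjoint H) {l ε : ℝ} (hε : 0 < ε) (hl : (l : ℂ) ∈ spectrum ℂ H) :
    ∃ (B : Finset (Lattice d)) (u : L2 d 𝓗), u ∈ supportedIn 𝓗 B ∧ u ≠ 0 ∧
      ‖H u - (l : ℂ) • u‖ ≤ ε * ‖u‖ := by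
  obtain ⟨v, hv⟩ : ∃ v, ‖H v - (l : ℂ) • v‖ < ε * ‖v‖ := by
    by_contra! h
    exact notMem_spectrum_of_le_norm hH hε h hl
  have hsum := lp.hasSum_single (p := 2) (by simp) v
  have hcont : Continuous fun w : L2 d 𝓗 => ε * ‖w‖ - ‖H w - (l : ℂ) • w‖ := by fun_prop
  obtain ⟨B, hB⟩ := (((hcont.tendsto v).comp hsum).eventually_const_lt (sub_pos.2 hv)).exists
  refine ⟨B, _, fun x hx => ?_, ?_, (sub_pos.1 hB).le⟩
  · rw [sum_single_apply B (fun x => x) fun x => v x, Finset.sum_ite_eq, if_neg hx]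
  · intro h0
    simp [h0] at hB
    exact absurd hB (norm_nonneg _).not_gt

theorem exists_abs_apply_le {d : ℕ} (B : Finset (Lattice d)) :
    ∃ n : ℕ, ∀ x ∈ B, ∀ i, |x i| ≤ (n : ℤ) := by
  refine ⟨∑ x ∈ B, ∑ i, (x i).natAbs, fun x hx i => ?_⟩
  rw [Int.abs_eq_natAbs, Nat.cast_le]
  exact (Finset.single_le_sum (f := fun i => (x i).natAbs) (fun _ _ => Nat.zero_le _)
    (Finset.mem_univ i)).trans (Finset.single_le_sum (f := fun x : Lattice d => ∑ i, (x i).natAbs)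
      (fun _ _ => Nat.zero_le _) hx)

variable {d : ℕ} {𝓗 : Type*} [NormedAddCommGroup 𝓗] [InnerProductSpace ℂ 𝓗]
  [FiniteDimensional ℂ 𝓗] [CompleteSpace 𝓗] {H : L2 d 𝓗 →L[ℂ] L2 d 𝓗} (hH : IsSelfAdjoint H)

theorem finrank_add_volumeCount_sub_le {Q : Finset (Lattice d)} {l ε : ℝ} (hε : 0 < ε)
    {W : Submodule ℂ (L2 d 𝓗)} (hW : W ≤ supportedIn 𝓗 Q)
    (h : ∀ u ∈ W, ‖H u - (l : ℂ) • u‖ ≤ ε * ‖u‖) :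
    finrank ℂ W + volumeCount hH Q (l - 2 * ε) ≤ volumeCount hH Q (l + ε) := by
  rw [← (Submodule.submoduleOfEquivOfLe hW).finrank_eq]
  refine finrank_le_eigenvalueCount_sub _ hε fun u hu => ?_
  have hproj : compression H Q u - (l : ℂ) • u =
      (supportedIn 𝓗 Q).orthogonalProjectionOnto (H (u : L2 d 𝓗) - (l : ℂ) • (u : L2 d 𝓗)) := by
    rw [map_sub, map_smul, Submodule.orthogonalProjectionOnto_mem_subspace_eq_self]
    rfl
  rw [ContinuousLinearMap.coe_coe, hproj]
  refine le_trans ?_ (h u hu)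
  exact (supportedIn 𝓗 Q).norm_orthogonalProjectionOnto_apply_le _

/-- Localised approximate eigenvectors with disjoint supports force eigenvalues in a window. -/
theorem card_add_volumeCount_sub_le {Q K : Finset (Lattice d)} {C : Lattice d → Finset (Lattice d)}
    (hCQ : ∀ x ∈ K, C x ⊆ Q) (hC : ∀ x ∈ K, ∀ y ∈ K, x ≠ y → Disjoint (C x) (C y))
    {w : Lattice d → L2 d 𝓗} (hw0 : ∀ x ∈ K, w x ≠ 0) (hw : ∀ x ∈ K, w x ∈ supportedIn 𝓗 (C x))
    (hHw : ∀ x ∈ K, H (w x) ∈ supportedIn 𝓗 (C x)) {l ε : ℝ} (hε : 0 < ε)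
    (h : ∀ x ∈ K, ‖H (w x) - (l : ℂ) • w x‖ ≤ ε * ‖w x‖) :
    K.card + volumeCount hH Q (l - 2 * ε) ≤ volumeCount hH Q (l + ε) := by
  have hli : LinearIndependent ℂ (fun x : K => w x) :=
    linearIndependent_of_ne_zero_of_inner_eq_zero (fun x => hw0 x x.2) fun x y hxy =>
      inner_eq_zero_of_disjoint (hC x x.2 y y.2 fun h => hxy (Subtype.ext h)) (hw x x.2) (hw y y.2)
  rw [← Fintype.card_coe K, ← finrank_span_eq_card hli]
  refine finrank_add_volumeCount_sub_le hH hε (Submodule.span_le.2 ?_) fun u hu => ?_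
  · rintro _ ⟨x, rfl⟩
    exact supportedIn_mono (hCQ x x.2) (hw x x.2)
  · obtain ⟨c, rfl⟩ := (Submodule.mem_span_range_iff_exists_fun ℂ).1 hu
    have hsub : H (∑ x : K, c x • w x) - (l : ℂ) • ∑ x : K, c x • w x =
        ∑ x : K, c x • (H (w x) - (l : ℂ) • w x) := by
      simp only [map_sum, map_smul, Finset.smul_sum, ← Finset.sum_sub_distrib, smul_sub,
        smul_comm (l : ℂ)]
    have hdisj (x y : K) (hxy : x ≠ y) : Disjoint (C x) (C y) :=
      hC x x.2 y y.2 fun h => hxy (Subtype.ext h)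
    -- The errors `H (w x) - l • w x` are also disjointly supported, so both sides split
    -- orthogonally and the same `ε` works for all combinations.
    refine le_of_sq_le_sq ?_ (by positivity)
    rw [hsub, mul_pow, norm_sum_sq_of_inner_eq_zero _ _ fun x _ y _ hxy =>
        inner_eq_zero_of_disjoint (hdisj x y hxy)
          (Submodule.smul_mem _ _ (sub_mem (hHw x x.2) (Submodule.smul_mem _ _ (hw x x.2))))
          (Submodule.smul_mem _ _ (sub_mem (hHw y y.2) (Submodule.smul_mem _ _ (hw y y.2)))),
      norm_sum_sq_of_inner_eq_zero _ _ fun x _ y _ hxy =>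
        inner_eq_zero_of_disjoint (hdisj x y hxy) (Submodule.smul_mem _ _ (hw x x.2))
          (Submodule.smul_mem _ _ (hw y y.2)), Finset.mul_sum]
    refine Finset.sum_le_sum fun x _ => ?_
    rw [norm_smul, norm_smul, mul_pow, mul_pow, mul_left_comm, ← mul_pow ε]
    gcongr
    exact h x x.2

/-- If `H - l` is bounded below, then eigenvectors of finite-volume operators for eigenvalues
near `l` live near the boundary. -/
theorem volumeCount_add_le_of_le_norm {R : ℕ} (hfr : HasRange H R) {l ε : ℝ} (hε : 0 < ε)
    (h : ∀ u, ε * ‖u‖ ≤ ‖H u - (l : ℂ) • u‖) (Q : Finset (Lattice d)) :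
    volumeCount hH Q (l + ε / 2) ≤
      (boundary R Q).ncard * finrank ℂ 𝓗 + volumeCount hH Q (l - ε / 2) := by
  obtain ⟨W, hWd, hW⟩ := exists_finrank_add_eigenvalueCount_ge (compression_isSymmetric hH Q)
    (l := l) (half_pos hε)
  have hle : W.map (supportedIn 𝓗 Q).subtype ≤ supportedIn 𝓗 Q := Submodule.map_subtype_le _ _
  have hbot : W.map (supportedIn 𝓗 Q).subtype ⊓ supportedIn 𝓗 (core R Q) = ⊥ := by
    refine (Submodule.eq_bot_iff _).2 ?_
    rintro _ ⟨⟨u, hu, rfl⟩, hucore⟩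
    -- For `u` supported in the core, `H u` stays inside `Q`. The compression then acts as `H`
    -- itself, and `ε‖u‖ ≤ (ε / 2)‖u‖` forces `u = 0`.
    have hHu : H (u : L2 d 𝓗) ∈ supportedIn 𝓗 Q := fun y hy =>
      apply_eq_zero_of_hasRange hfr hucore fun x hx => by
        by_contra! hxy
        exact hy (mem_core.1 hx y hxy)
    have hcomp : compression H Q u = ⟨H (u : L2 d 𝓗), hHu⟩ :=
      Submodule.orthogonalProjectionOnto_mem_subspace_eq_self
        (⟨H (u : L2 d 𝓗), hHu⟩ : supportedIn 𝓗 Q)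
    have h1 := hW u hu
    rw [ContinuousLinearMap.coe_coe, hcomp] at h1
    have h2 := (h u).trans h1
    have h3 : ‖u‖ = ‖(u : L2 d 𝓗)‖ := rfl
    have h4 : ‖(u : L2 d 𝓗)‖ ≤ 0 := by
      rw [h3] at h2
      nlinarith [norm_nonneg (u : L2 d 𝓗)]
    exact norm_le_zero_iff.1 h4
  have hdim := finrank_le_finrank_inf_add (core_subset R Q) hle
  rw [hbot, finrank_bot, zero_add, Submodule.finrank_map_subtype_eq] at hdim
  have hcard := Nat.mul_le_mul_right (finrank ℂ 𝓗) (card_sdiff_core_le R Q)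
  change volumeCount hH Q (l + ε / 2) ≤ finrank ℂ W + volumeCount hH Q (l - ε / 2) at hWd
  omega

theorem measure_Ioc_eq (μ : ProbabilityMeasure ℝ) (a b : ℝ) :
    (μ : Measure ℝ) (Set.Ioc a b) = ENNReal.ofReal
      (ProbabilityTheory.cdf (μ : Measure ℝ) b - ProbabilityTheory.cdf (μ : Measure ℝ) a) := by
  rw [← StieltjesFunction.measure_Ioc, ProbabilityTheory.measure_cdf]

theorem notMem_support_of_notMem_spectrum [Nontrivial 𝓗] {R : ℕ} (hfr : HasRange H R)
    {Q : ℕ → Finset (Lattice d)} (hQ : IsVanHove Q) {μ : ProbabilityMeasure ℝ}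
    (hμ : IsDensityOfStates hH Q μ) {l : ℝ} (hl : (l : ℂ) ∉ spectrum ℂ H) :
    l ∉ (μ : Measure ℝ).support := by
  obtain ⟨ε, hε, h⟩ := exists_le_norm_of_notMem_spectrum hl
  have hlim := le_of_tendsto_of_tendsto' ((hμ.tendsto_at (l + ε / 2)).sub
    (hμ.tendsto_at (l - ε / 2))) (hQ.2 R) fun j => by
      have hq : (0 : ℝ) < (Q j).card := by exact_mod_cast (hQ.1 j).card_pos
      have hD : (0 : ℝ) < finrank ℂ 𝓗 := by exact_mod_cast finrank_pos
      have := (Nat.cast_le (α := ℝ)).2 (volumeCount_add_le_of_le_norm hH hfr hε h (Q j))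
      push_cast at this
      rw [normalisedCount_eq, normalisedCount_eq, ← sub_div,
        ← mul_div_mul_right ((boundary R (Q j)).ncard : ℝ) _ hD.ne']
      refine div_le_div_of_nonneg_right ?_ (by positivity)
      linarith
  refine Measure.notMem_support_iff_exists.2 ⟨Set.Ioc (l - ε / 2) (l + ε / 2),
    Ioc_mem_nhds (by linarith) (by linarith), ?_⟩
  rw [measure_Ioc_eq]
  exact ENNReal.ofReal_of_nonpos hlim

variable {A : Type*} {Λ : Lattice d → A} {R : ℕ}

omit [FiniteDimensional ℂ 𝓗] in
/-- An approximate eigenvector can be transported to every occurrence of the pattern seen by it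
and its image under `H`. -/
theorem exists_approximate_eigenvectors (hH : IsSelfAdjoint H) (hfr : HasRange H R) (hinv : IsInvariantWith Λ H R)
    {l ε : ℝ} (hε : 0 < ε) (hl : (l : ℂ) ∈ spectrum ℂ H) :
    ∃ (L : ℕ) (a : Lattice d), 1 ≤ L ∧ ∀ x, patternAt Λ L x = patternAt Λ L a →
      ∃ w : L2 d 𝓗, w ≠ 0 ∧ w ∈ supportedIn 𝓗 (cubeAt L x) ∧ H w ∈ supportedIn 𝓗 (cubeAt L x) ∧
        ‖H w - (l : ℂ) • w‖ ≤ ε * ‖w‖ := by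
  obtain ⟨B, u, huB, hu0, hu⟩ := exists_supportedIn_norm_le hH hε hl
  obtain ⟨n, hn⟩ := exists_abs_apply_le B
  -- With `B` inside `[-n, n]^d`, one margin `R` makes room for `H u` (the cube `B'`), and a second
  -- for the cubes `C_R` at the points of `B'`.
  set L := 2 * (n + 2 * R) + 1 with hL
  set a : Lattice d := fun _ => -((n + 2 * R : ℕ) : ℤ) with ha
  set B' : Finset (Lattice d) := cubeAt (2 * (n + R) + 1) (fun _ => -((n + R : ℕ) : ℤ)) with hB'
  have hBB' : B ⊆ B' := fun x hx => mem_cubeAt.2 fun i => by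
    have := abs_le.1 (hn x hx i)
    omega
  have hcube : ∀ y ∈ B', ∀ z ∈ cubeAt R y, z ∈ cubeAt L a := by
    refine fun y hy z hz => mem_cubeAt.2 fun i => ?_
    have h1 := mem_cubeAt.1 hy i
    have h2 := mem_cubeAt.1 hz i
    simp only [ha, hL]
    omega
  have hB'a : B' ⊆ cubeAt L a := fun y hy => mem_cubeAt.2 fun i => by
    have h1 := mem_cubeAt.1 hy i
    simp only [ha, hL]
    omega
  have hfar : ∀ y, y ∉ B' → ∀ x ∈ B, (R : ℝ) < dist x y := by
    intro y hy x hx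
    by_contra! hxy
    rw [dist_le_natCast] at hxy
    refine hy (mem_cubeAt.2 fun i => ?_)
    have h1 := abs_le.1 (hn x hx i)
    have h2 := abs_le.1 (hxy i)
    omega
  have hHu : H u ∈ supportedIn 𝓗 B' := fun y hy =>
    apply_eq_zero_of_hasRange hfr huB (hfar y hy)
  refine ⟨L, a, by omega, fun x hx => ?_⟩
  obtain ⟨t, rfl⟩ : ∃ t, x = a + t := ⟨x - a, by simp⟩
  have hentry : ∀ y ∈ B', ∀ z ∈ B, ∀ v, entry H y z v = entry H (y + t) (z + t) v := by
    refine fun y hy z hz => hinv z y t fun p hp => ?_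
    have hpa : p ∈ cubeAt L a :=
      (Finset.mem_union.1 hp).elim (hcube z (hBB' hz) p) (hcube y hy p)
    have hp0 : p - a ∈ cube d L := by
      change p - a ∈ cubeAt L 0
      rwa [← mem_translate, ← cubeAt_add, zero_add]
    have := congrFun hx ⟨p - a, hp0⟩
    simp only [patternAt] at this
    rwa [add_sub_cancel, add_right_comm, add_sub_cancel] at this
  -- Cutting off at `B` or at `B'` is the same for `u`, so a single map transports both `u` and `H
  -- u`.
  have hshift : shift 𝓗 B t u = shift 𝓗 B' t u := by
    ext y
    obtain ⟨z, rfl⟩ : ∃ z, y = z + t := ⟨y - t, by simp⟩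
    rw [shift_apply_add_of_mem t huB, shift_apply_add_of_mem t (supportedIn_mono hBB' huB)]
  have hHshift : H (shift 𝓗 B t u) = shift 𝓗 B' t (H u) := by
    ext y
    obtain ⟨z, rfl⟩ : ∃ z, y = z + t := ⟨y - t, by simp⟩
    rw [shift_apply_add]
    split_ifs with hz
    · exact apply_shift H huB (hentry z hz)
    · refine apply_eq_zero_of_hasRange hfr (shift_mem B t u) fun y hy => ?_
      rw [mem_translate] at hy
      have := hfar z hz _ hy
      rwa [← dist_add_right _ _ t, sub_add_cancel] at this
  have htrans : translate B' t ⊆ cubeAt L (a + t) := by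
    rw [cubeAt_add]
    exact Finset.map_subset_map.2 hB'a
  have huB' := supportedIn_mono hBB' huB
  refine ⟨shift 𝓗 B t u, ?_, ?_, ?_, ?_⟩
  · rw [← norm_ne_zero_iff, norm_shift t huB]
    exact norm_ne_zero_iff.2 hu0
  · rw [hshift]
    exact supportedIn_mono htrans (shift_mem B' t u)
  · rw [hHshift]
    exact supportedIn_mono htrans (shift_mem B' t (H u))
  · rw [hHshift, hshift, ← map_smul, ← map_sub, norm_shift t huB',
      norm_shift t (sub_mem hHu (Submodule.smul_mem _ _ huB'))]
    exact hu

/-- Occurrences in one class modulo `L` carry disjoint copies of the approximate eigenvector.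
Summing over the `L ^ d` classes bounds the pattern count by `L ^ d` times the number of eigenvalues
in the window; in the limit the mass of the window is at least a positive multiple of the frequency.
-/
theorem mem_support_of_mem_spectrum [Nontrivial 𝓗] {Q : ℕ → Finset (Lattice d)}
    (hQ : ∀ j, (Q j).Nonempty) {ν : Pattern d A → ℝ}
    (hν : ∀ P : Pattern d A, P.IsBoxAtOrigin → HasFrequency Λ Q P (ν P))
    (hfr : HasRange H R) (hinv : IsInvariantWith Λ H R) {μ : ProbabilityMeasure ℝ}
    (hμ : IsDensityOfStates hH Q μ)
    (hpos : ∀ P : Pattern d A, P.IsBoxAtOrigin → (∃ x, P.OccursAt Λ x) → 0 < ν P)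
    {l : ℝ} (hl : (l : ℂ) ∈ spectrum ℂ H) : l ∈ (μ : Measure ℝ).support := by
  classical
  refine (Measure.mem_support_iff_forall l).2 fun U hU => ?_
  obtain ⟨δ, hδ, hδU⟩ := Metric.mem_nhds_iff.1 hU
  -- The window from `l - 2 * ε` to `l + ε` must fit inside the ball of radius `δ`.
  have hε : 0 < δ / 3 := by positivity
  have hsub : Set.Ioc (l - 2 * (δ / 3)) (l + δ / 3) ⊆ U := fun s hs => hδU (by
    rw [Metric.mem_ball, Real.dist_eq, abs_lt]
    constructor <;> linarith [hs.1, hs.2])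
  refine lt_of_lt_of_le ?_ (measure_mono hsub)
  rw [measure_Ioc_eq, ENNReal.ofReal_pos]
  obtain ⟨L, a, hL, h⟩ := exists_approximate_eigenvectors hH hfr hinv hε hl
  choose! w hw0 hw hHw hwl using h
  have : NeZero L := ⟨by omega⟩
  have hcount (S : Finset (Lattice d)) :
      (⟨cube d L, patternAt Λ L a⟩ : Pattern d A).count Λ S +
          L ^ d * volumeCount hH S (l - 2 * (δ / 3)) ≤
        L ^ d * volumeCount hH S (l + δ / 3) := by
    have hmul (n : ℕ) : L ^ d * n = ∑ _r : Fin d → ZMod L, n := by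
      rw [Finset.sum_const, Finset.card_univ, Fintype.card_fun, ZMod.card, Fintype.card_fin,
        smul_eq_mul]
    rw [count_eq_card_filter, Finset.card_filter, ← sum_tiling L S, hmul, hmul,
      ← Finset.sum_add_distrib]
    refine Finset.sum_le_sum fun r _ => ?_
    rw [← Finset.card_filter]
    refine card_add_volumeCount_sub_le hH (C := cubeAt L) (w := w) ?_ ?_ ?_ ?_ ?_ hε ?_
    · exact fun x hx =>
        cubeAt_subset_of_mem_corners (mem_tiling.1 (Finset.mem_filter.1 hx).1).1
    · exact fun x hx y hy =>
        disjoint_cubeAt_of_mem_tiling (Finset.mem_filter.1 hx).1 (Finset.mem_filter.1 hy).1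
    · exact fun x hx => hw0 x (Finset.mem_filter.1 hx).2
    · exact fun x hx => hw x (Finset.mem_filter.1 hx).2
    · exact fun x hx => hHw x (Finset.mem_filter.1 hx).2
    · exact fun x hx => hwl x (Finset.mem_filter.1 hx).2
  have hbox := isBoxAtOrigin_cube hL (patternAt Λ L a)
  have hν0 := hpos _ hbox ⟨a, (occursAt_iff Λ).2 rfl⟩
  have hD : (0 : ℝ) < finrank ℂ 𝓗 := by exact_mod_cast finrank_pos
  have hL0 : (0 : ℝ) < L := by exact_mod_cast hL
  have hlim := le_of_tendsto_of_tendsto' (hν _ hbox) (((hμ.tendsto_at (l + δ / 3)).sub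
    (hμ.tendsto_at (l - 2 * (δ / 3)))).const_mul ((L : ℝ) ^ d * finrank ℂ 𝓗)) fun j => by
      have hq : (0 : ℝ) < (Q j).card := by exact_mod_cast (hQ j).card_pos
      have := (Nat.cast_le (α := ℝ)).2 (hcount (Q j))
      push_cast at this
      rw [normalisedCount_eq, normalisedCount_eq, ← sub_div, mul_comm ((Q j).card : ℝ),
        mul_assoc, ← mul_div_assoc, mul_div_mul_left _ _ hD.ne', ← mul_div_assoc]
      refine div_le_div_of_nonneg_right ?_ hq.le
      linarith
  exact pos_of_mul_pos_right (hν0.trans_le hlim) (by positivity)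

theorem spectrum_eq_image_support [Nontrivial 𝓗] {Q : ℕ → Finset (Lattice d)}
    (hQ : IsVanHove Q) {ν : Pattern d A → ℝ}
    (hν : ∀ P : Pattern d A, P.IsBoxAtOrigin → HasFrequency Λ Q P (ν P))
    (hfr : HasRange H R) (hinv : IsInvariantWith Λ H R) {μ : ProbabilityMeasure ℝ}
    (hμ : IsDensityOfStates hH Q μ)
    (hpos : ∀ P : Pattern d A, P.IsBoxAtOrigin → (∃ x, P.OccursAt Λ x) → 0 < ν P) :
    spectrum ℂ H = (fun t : ℝ => (t : ℂ)) '' (μ : Measure ℝ).support := by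
  ext z
  constructor
  · intro hz
    have hre := hH.mem_spectrum_eq_re hz
    refine ⟨z.re, ?_, hre.symm⟩
    rw [hre] at hz
    exact mem_support_of_mem_spectrum hH hQ.1 hν hfr hinv hμ hpos hz
  · rintro ⟨l, hl, rfl⟩
    by_contra h
    exact notMem_support_of_notMem_spectrum hH hfr hQ hμ h hl

end Spectrum

end ZdIDS

end

/-! ### The main theorem -/

theorem theorem4p1 {d : ℕ} {A : Type*} [Fintype A]
    {𝓗 : Type*} [NormedAddCommGroup 𝓗] [InnerProductSpace ℂ 𝓗] [FiniteDimensional ℂ 𝓗]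
    [CompleteSpace 𝓗] [Nontrivial 𝓗]
    (Λ : ZdIDS.Lattice d → A)
    (Q : ℕ → Finset (ZdIDS.Lattice d)) (hQ : ZdIDS.IsVanHove Q)
    (ν : ZdIDS.Pattern d A → ℝ)
    (hν : ∀ P : ZdIDS.Pattern d A, P.IsBoxAtOrigin → ZdIDS.HasFrequency Λ Q P (ν P))
    (H : ZdIDS.L2 d 𝓗 →L[ℂ] ZdIDS.L2 d 𝓗) (hH : IsSelfAdjoint H)
    (Rfr Rinv : ℕ) (hfr : ZdIDS.HasRange H Rfr) (hinv : ZdIDS.IsInvariantWith Λ H Rinv)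
    (R : ℕ) (hR : R = max Rfr Rinv) :
    (∃! μ : ProbabilityMeasure ℝ, ZdIDS.IsDensityOfStates hH Q μ) ∧
    ∀ μ : ProbabilityMeasure ℝ, ZdIDS.IsDensityOfStates hH Q μ →
      (∀ j M : ℕ, 1 ≤ M → ∀ t : ℝ,
        |ZdIDS.normalisedCount hH (Q j) t - ProbabilityTheory.cdf (μ : Measure ℝ) t| ≤
          8 * (((ZdIDS.boundary R (ZdIDS.cube d M)).ncard : ℝ) / ((ZdIDS.cube d M).card : ℝ))
          + ∑ p : (ZdIDS.cube d M → A),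
              |((⟨ZdIDS.cube d M, p⟩ : ZdIDS.Pattern d A).count Λ (Q j) : ℝ) / ((Q j).card : ℝ)
                - ν ⟨ZdIDS.cube d M, p⟩|
          + 5 * ((ZdIDS.cube d R).card : ℝ)
              * (((ZdIDS.boundary M (Q j)).ncard : ℝ) / ((Q j).card : ℝ))) ∧
      ((∀ P : ZdIDS.Pattern d A, P.IsBoxAtOrigin → (∃ x, P.OccursAt Λ x) → 0 < ν P) →
        spectrum ℂ H = (fun t : ℝ => (t : ℂ)) '' (μ : Measure ℝ).support) := by
  have hfrR : ZdIDS.HasRange H R := hfr.mono (hR ▸ le_max_left _ _)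
  have hinvR : ZdIDS.IsInvariantWith Λ H R := hinv.mono Λ (hR ▸ le_max_right _ _)
  refine ⟨?_, fun μ hμ => ⟨fun j M hM t =>
    ZdIDS.abs_normalisedCount_sub_cdf_le hH hQ hν hfrR hinvR hμ j hM t,
    ZdIDS.spectrum_eq_image_support hH hQ hν hfrR hinvR hμ⟩⟩
  obtain ⟨N, hN⟩ := ZdIDS.exists_tendstoUniformly_normalisedCount hH hQ hν hfrR hinvR
  obtain ⟨μ, hμ⟩ := ZdIDS.exists_isDensityOfStates hH hQ.1 hN
  exact ⟨μ, hμ, fun μ' hμ' => hμ'.unique hH hμ⟩
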